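/- Let $\mathbb T=\mathbb R/2\pi\mathbb Z$, $\langle x\rangle=1+|x|$, and let $\widehat f(n,\tau)$ ($n\in\mathbb Z$, $\tau\in\mathbb R$) be the space-time Fourier transform of $f:\mathbb T\times\mathbb R\to\mathbb C$, $\widehat f(n,\tau)=(2\pi)^{-1}\int_{\mathbb R}\int_{\mathbb T}e^{-it\tau}e^{-inx}f(x,t)\,dx\,dt$ (understood in the sense of tempered distributions). For $k,s,b\in\mathbb R$ put $$\|f\|_{X^{k,b}}=\Big(\sum_{n}\int\langle n\rangle^{2k}\langle\tau+n^2\rangle^{2b}|\widehat f(n,\tau)|^2d\tau\Big)^{1/2},\qquad \|g\|_{Y^{s,b}}=\Big(\sum_{n}\int\langle n\rangle^{2s}\langle\tau-n^3\rangle^{2b}|\widehat g(n,\tau)|^2d\tau\Big)^{1/2},$$ $$\|f\|_{Z^k}=\|f\|_{X^{k,-1/2}}+\Big(\sum_n\Big(\int\frac{\langle n\rangle^k|\widehat f(n,\tau)|}{\langle\tau+n^2\rangle}d\tau\Big)^2\Big)^{1/2}.$$ Below, $u,v$ range over $L^2(\mathbb T\times\mathbb R)$ (which contains $X^{k,b}$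 and $Y^{s,b}$ when $k,s,b\ge 0$), and constants $C$ do not depend on $u,v$. (1) There is $\varepsilon_0>0$ such that for all $0<\varepsilon\le\varepsilon_0$ and all $k\ge 0$, $s\ge 0$ with $k-s\le 3/2$ there is $C=C(k,s,\varepsilon)$ with $$\|uv\|_{Z^k}\le C\big(\|u\|_{X^{k,1/2-\varepsilon}}\|v\|_{Y^{s,1/2}}+\|u\|_{X^{k,1/2}}\|v\|_{Y^{s,1/2-\varepsilon}}\big)\quad\text{for all }u,v. \qquad (*)$$ (2) If $k,s\in\mathbb R$ satisfy $s<0$ or $k-s>3/2$, then for every $\varepsilon>0$ the estimate $(*)$ fails for every constant $C$. (3) More precisely, for $k,s\in\mathbb R$, if there is $C$ with $\|uv\|_{X^{k,-1/2}}\le C\|u\|_{X^{k,1/2}}\|v\|_{Y^{s,1/2}}$ for all $u,v$, then $s\ge 0$ and $k-s\le 3/2$. -/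

import Mathlib

open MeasureTheory
open scoped ENNReal NNReal SchwartzMap

namespace NLSKdV

instance factTwoPiPos : Fact (0 < 2 * Real.pi) := ⟨Real.two_pi_pos⟩

/-- The torus `ℝ / 2πℤ`, with Lebesgue measure of total mass `2π`. -/
abbrev Torus : Type := AddCircle (2 * Real.pi)

/-- The bracket `⟨x⟩ = 1 + |x|`. -/
noncomputable def bracket (x : ℝ) : ℝ := 1 + |x|

/-- The (non-unitary) Fourier transform `∫ e^{-itτ} φ(τ) dτ` of a test function of one real
variable, evaluated at `t`. -/
noncomputable def testFourier (φ : 𝓢(ℝ, ℂ)) (t : ℝ) : ℂ :=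
  ∫ τ : ℝ, Complex.exp (-(Complex.I * t * τ)) * φ τ

/-- `F` is the space-time Fourier transform
`F n τ = (2π)⁻¹ ∫∫ e^{-itτ} e^{-inx} f(x,t) dx dt` of `f`, in the usual sense of tempered
distributions: for every `n`, both sides agree when tested against Schwartz functions of `τ`.
Such an `F` is unique up to null sets of `τ`; for integrable `f` it is given by the integral above,
and it exists also for every square integrable `f`. Here `fourier (-n) x = e^{-inx}`. -/
def HasFourier (f : Torus × ℝ → ℂ) (F : ℤ → ℝ → ℂ) : Prop :=
  ∀ (n : ℤ) (φ : 𝓢(ℝ, ℂ)),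
    Integrable (fun τ : ℝ => F n τ * φ τ) ∧
    Integrable (fun p : Torus × ℝ => fourier (-n) p.1 * f p * testFourier φ p.2) ∧
    ∫ τ : ℝ, F n τ * φ τ =
      (2 * (Real.pi : ℂ))⁻¹ *
        ∫ p : Torus × ℝ, fourier (-n) p.1 * f p * testFourier φ p.2

/-- The weighted `L²_{n,τ}` norm
`(∑ₙ ∫ ⟨n⟩^{2r} ⟨τ - h(n)⟩^{2b} |F(n,τ)|² dτ)^{1/2}`. -/
noncomputable def weightedL2 (h : ℤ → ℝ) (r b : ℝ) (F : ℤ → ℝ → ℂ) : ℝ≥0∞ :=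
  (∑' n : ℤ, ∫⁻ τ : ℝ,
    ENNReal.ofReal (bracket n ^ (2 * r) * bracket (τ - h n) ^ (2 * b)) * ‖F n τ‖ₑ ^ 2)
      ^ (1 / 2 : ℝ)

/-- The norm `‖⟨n⟩^r ⟨τ - h(n)⟩⁻¹ F(n,τ)‖_{L²_n L¹_τ}`. -/
noncomputable def weightedL2L1 (h : ℤ → ℝ) (r : ℝ) (F : ℤ → ℝ → ℂ) : ℝ≥0∞ :=
  (∑' n : ℤ, (∫⁻ τ : ℝ,
    ENNReal.ofReal (bracket n ^ r / bracket (τ - h n)) * ‖F n τ‖ₑ) ^ 2) ^ (1 / 2 : ℝ)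

/-- `τ - schrodingerPhase n = τ + n²`. -/
def schrodingerPhase (n : ℤ) : ℝ := -(n : ℝ) ^ 2

/-- `τ - airyPhase n = τ - n³`. -/
def airyPhase (n : ℤ) : ℝ := (n : ℝ) ^ 3

/-- The Bourgain norm `‖f‖_{X^{k,b}}`: the value of the weighted norm at the Fourier transform of
`f` (`⊤` if that transform is not a function; the infimum is over almost everywhere equal
representatives only). -/
noncomputable def XNorm (k b : ℝ) (f : Torus × ℝ → ℂ) : ℝ≥0∞ :=
  ⨅ (F : ℤ → ℝ → ℂ) (_ : HasFourier f F), weightedL2 schrodingerPhase k b F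

/-- The Bourgain norm `‖g‖_{Y^{s,b}}`. -/
noncomputable def YNorm (s b : ℝ) (g : Torus × ℝ → ℂ) : ℝ≥0∞ :=
  ⨅ (G : ℤ → ℝ → ℂ) (_ : HasFourier g G), weightedL2 airyPhase s b G

/-- The companion norm
`‖f‖_{Z^k} = ‖f‖_{X^{k,-1/2}} + ‖⟨n⟩^k ⟨τ+n²⟩⁻¹ f̂(n,τ)‖_{L²_n L¹_τ}`. -/
noncomputable def ZNorm (k : ℝ) (f : Torus × ℝ → ℂ) : ℝ≥0∞ :=
  XNorm k (-(1 / 2)) f +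
    ⨅ (F : ℤ → ℝ → ℂ) (_ : HasFourier f F), weightedL2L1 schrodingerPhase k F

/-- The estimate
`‖uv‖_{Z^k} ≤ C (‖u‖_{X^{k,1/2-ε}} ‖v‖_{Y^{s,1/2}} + ‖u‖_{X^{k,1/2}} ‖v‖_{Y^{s,1/2-ε}})`
with a constant independent of `u` and `v`. -/
def CouplingEstimate (k s ε : ℝ) : Prop :=
  ∃ C : ℝ≥0, ∀ u v : Torus × ℝ → ℂ, MemLp u 2 → MemLp v 2 →
    ZNorm k (fun p => u p * v p) ≤
      C * (XNorm k (1 / 2 - ε) u * YNorm s (1 / 2) v +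
        XNorm k (1 / 2) u * YNorm s (1 / 2 - ε) v)

/-- The estimate `‖uv‖_{X^{k,-1/2}} ≤ C ‖u‖_{X^{k,1/2}} ‖v‖_{Y^{s,1/2}}` with a constant
independent of `u` and `v`. -/
def EndpointEstimate (k s : ℝ) : Prop :=
  ∃ C : ℝ≥0, ∀ u v : Torus × ℝ → ℂ, MemLp u 2 → MemLp v 2 →
    XNorm k (-(1 / 2)) (fun p => u p * v p) ≤ C * (XNorm k (1 / 2) u * YNorm s (1 / 2) v)

end NLSKdV

/-!
The sufficiency of `0 ≤ s` and `k - s ≤ 3/2` is a weighted convolution estimate on the frequency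
space `ℤ × ℝ`. By Plancherel in time and Parseval in space (`enorm_intFourier_mul_le`), the
transform of `u v` at `(n, τ)` is dominated by the convolution of `|û|` and `|v̂|`. Let `m` and
`n - m` be the frequencies of the factors. The three modulations satisfy
`(τ + n²) - (σ + m²) - (τ - σ - (n - m)³) = (n - m)³ + n² - m²`.

* If `|n| ≤ 2 |m|`, the derivative weight `⟨n⟩^k` falls on `u` at no cost.
* If `2 |m| < |n|`, the weights cost at most `⟨n⟩^{3/2} ⟨m⟩⁻¹`, by `k - s ≤ 3/2`, while the
  right-hand side above is of size `|n|³` for large `n`. Hence one of the modulations is at least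
  comparable to `⟨n⟩³`, and half a power of it pays for `⟨n⟩^{3/2}`.

This is `exists_bracketPow_le`. What remains are convolutions with kernels that are products of two
powers `⟨modulation⟩^{-7/16}`, bounded on `L²` by Cauchy–Schwarz or, by duality, by a Schur test
(`lintegral_sq_convolution_le_of_output`, `..._of_left`, `..._of_right`). Integrating such a kernel
squared in the time frequency leaves `⟨p⟩^{-1/2}`, where `p` is a monic cubic polynomial of the
remaining integer variable when the largest modulation is that of the output or of `u`; these sums
are bounded uniformly in the coefficients, since `|p|` is at least the cube of the distance to the
nearest real part of a root (`exists_tsum_bracketPow_cubic_le`). When the modulation of `v` is the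
largest, `p` is only affine, but then the gain `⟨m⟩⁻¹` makes the sum over `m` converge. The
exponents leave room for `ε = 1/16`, and smaller `ε` give weaker estimates. The `L¹` part of the
companion norm follows from Cauchy–Schwarz in `τ`, because the loss in the case of a large output
modulation is supported where `⟨τ + n²⟩` is at least comparable to `⟨n⟩³`, and
`R ∫ (R + |x|)⁻² dx` does not depend on `R`.

For the necessity, the coupling estimate implies the endpoint estimate, which is tested on
Gaussian wave packets `e^{imx - im²t - t²}` and `e^{ilx + il³t - t²}`
(`EndpointEstimate.exists_bracket_le`). The resonant choice `l = 2j`, `m = -j (2j + 1)` forces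
`s ≥ 0`, and `m = 0` forces `k - s ≤ 3/2`.
-/

namespace NLSKdV

/-! ### The space-time Fourier transform: uniqueness, and the case of integrable functions -/

/-- Two functions whose products with every Schwartz function are integrable with equal integrals
agree almost everywhere. -/
theorem ae_eq_of_integral_mul_schwartz {F G : ℝ → ℂ}
    (hF : ∀ φ : 𝓢(ℝ, ℂ), Integrable (fun τ => F τ * φ τ))
    (hG : ∀ φ : 𝓢(ℝ, ℂ), Integrable (fun τ => G τ * φ τ))
    (h : ∀ φ : 𝓢(ℝ, ℂ), ∫ τ, F τ * φ τ = ∫ τ, G τ * φ τ) : F =ᵐ[volume] G := by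
  have key : ∀ F : ℝ → ℂ, (∀ φ : 𝓢(ℝ, ℂ), Integrable (fun τ => F τ * φ τ)) →
      LocallyIntegrable F := by
    intro F hF
    rw [locallyIntegrable_iff]
    intro K hK
    obtain ⟨R, hR⟩ := hK.isBounded.subset_closedBall 0
    let b : ContDiffBump (0 : ℝ) := ⟨|R| + 1, |R| + 2, by positivity, by linarith⟩
    have hcs : HasCompactSupport (fun x => ((b x : ℝ) : ℂ)) :=
      b.hasCompactSupport.comp_left (g := fun x : ℝ => (x : ℂ)) Complex.ofReal_zero
    have hsm : ContDiff ℝ (⊤ : ℕ∞) (fun x => ((b x : ℝ) : ℂ)) :=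
      Complex.ofRealCLM.contDiff.comp b.contDiff
    have hi := hF (hcs.toSchwartzMap hsm)
    refine (hi.integrableOn (s := K)).congr_fun ?_ hK.measurableSet
    intro x hx
    have hb : b x = 1 := by
      apply b.one_of_mem_closedBall
      have := hR hx
      simp only [Metric.mem_closedBall, dist_zero_right] at this ⊢
      exact this.trans ((le_abs_self R).trans (by simp [b]))
    simp [hb]
  refine ae_eq_of_integral_contDiff_smul_eq (key F hF) (key G hG) ?_
  intro g hg hcs
  have hcs' : HasCompactSupport (fun x => ((g x : ℝ) : ℂ)) :=
    hcs.comp_left (g := fun x : ℝ => (x : ℂ)) Complex.ofReal_zero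
  have hsm : ContDiff ℝ (⊤ : ℕ∞) (fun x => ((g x : ℝ) : ℂ)) :=
    Complex.ofRealCLM.contDiff.comp hg
  have := h (hcs'.toSchwartzMap hsm)
  simpa [mul_comm] using this

theorem HasFourier.ae_eq {f : Torus × ℝ → ℂ} {F G : ℤ → ℝ → ℂ} (hF : HasFourier f F)
    (hG : HasFourier f G) (n : ℤ) : F n =ᵐ[volume] G n :=
  ae_eq_of_integral_mul_schwartz (fun φ => (hF n φ).1) (fun φ => (hG n φ).1)
    fun φ => (hF n φ).2.2.trans (hG n φ).2.2.symm

theorem HasFourier.weightedL2_eq {f : Torus × ℝ → ℂ} {F G : ℤ → ℝ → ℂ} (hF : HasFourier f F)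
    (hG : HasFourier f G) (h : ℤ → ℝ) (r b : ℝ) : weightedL2 h r b F = weightedL2 h r b G := by
  unfold weightedL2
  congr 2
  ext n
  refine lintegral_congr_ae ?_
  filter_upwards [hF.ae_eq hG n] with τ hτ
  rw [hτ]

theorem HasFourier.xNorm_eq {f : Torus × ℝ → ℂ} {F : ℤ → ℝ → ℂ} (hF : HasFourier f F) (k b : ℝ) :
    XNorm k b f = weightedL2 schrodingerPhase k b F :=
  le_antisymm (iInf₂_le F hF) (le_iInf₂ fun _ hG => (hF.weightedL2_eq hG _ _ _).le)

theorem HasFourier.yNorm_eq {f : Torus × ℝ → ℂ} {F : ℤ → ℝ → ℂ} (hF : HasFourier f F) (s b : ℝ) :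
    YNorm s b f = weightedL2 airyPhase s b F :=
  le_antisymm (iInf₂_le F hF) (le_iInf₂ fun _ hG => (hF.weightedL2_eq hG _ _ _).le)

theorem HasFourier.zNorm_le {f : Torus × ℝ → ℂ} {F : ℤ → ℝ → ℂ} (hF : HasFourier f F) (k : ℝ) :
    ZNorm k f ≤ weightedL2 schrodingerPhase k (-(1 / 2)) F + weightedL2L1 schrodingerPhase k F :=
  add_le_add (iInf₂_le F hF) (iInf₂_le F hF)

/-- The Fourier transform of an integrable function, given by the absolutely convergent integral. -/
noncomputable def intFourier (f : Torus × ℝ → ℂ) (n : ℤ) (τ : ℝ) : ℂ :=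
  (2 * (Real.pi : ℂ))⁻¹ *
    ∫ p : Torus × ℝ, fourier (-n) p.1 * f p * Complex.exp (-(Complex.I * p.2 * τ))

theorem norm_fourier_apply (n : ℤ) (x : Torus) : ‖fourier n x‖ = 1 := by
  rw [fourier_apply]
  exact Circle.norm_coe _

theorem norm_cexp_neg_I_mul (t τ : ℝ) : ‖Complex.exp (-(Complex.I * t * τ))‖ = 1 := by
  rw [show -(Complex.I * t * τ) = ((-(t * τ) : ℝ) : ℂ) * Complex.I by push_cast; ring,
    Complex.norm_exp_ofReal_mul_I]

theorem hasFourier_intFourier {f : Torus × ℝ → ℂ} (hf : Integrable f) :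
    HasFourier f (intFourier f) := by
  intro n φ
  have hint : Integrable (fun q : (Torus × ℝ) × ℝ =>
      fourier (-n) q.1.1 * f q.1 * Complex.exp (-(Complex.I * q.1.2 * q.2)) * φ q.2)
      (volume.prod volume) := by
    have h0 : Integrable (fun q : (Torus × ℝ) × ℝ => f q.1 * φ q.2) (volume.prod volume) :=
      hf.mul_prod φ.integrable
    have h1 := h0.bdd_mul (c := 1)
      (f := fun q : (Torus × ℝ) × ℝ =>
        fourier (-n) q.1.1 * Complex.exp (-(Complex.I * q.1.2 * q.2)))
      (by
        refine Continuous.aestronglyMeasurable ?_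
        have := (fourier (T := 2 * Real.pi) (-n)).continuous
        fun_prop)
      (by
        refine Filter.Eventually.of_forall fun q => ?_
        rw [norm_mul, norm_fourier_apply, norm_cexp_neg_I_mul, one_mul])
    refine h1.congr (Filter.Eventually.of_forall fun q => ?_)
    ring
  have hr := hint.integral_prod_right
  have hl := hint.integral_prod_left
  have e1 : ∀ τ : ℝ, ∫ p : Torus × ℝ,
      fourier (-n) p.1 * f p * Complex.exp (-(Complex.I * p.2 * τ)) * φ τ =
      (∫ p : Torus × ℝ, fourier (-n) p.1 * f p * Complex.exp (-(Complex.I * p.2 * τ))) * φ τ :=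
    fun τ => integral_mul_const _ _
  have e2 : ∀ p : Torus × ℝ, ∫ τ : ℝ,
      fourier (-n) p.1 * f p * Complex.exp (-(Complex.I * p.2 * τ)) * φ τ =
      fourier (-n) p.1 * f p * testFourier φ p.2 := by
    intro p
    rw [testFourier, ← integral_const_mul]
    congr 1
    ext τ
    ring
  simp only [e1] at hr
  simp only [e2] at hl
  refine ⟨?_, hl, ?_⟩
  · refine (hr.const_mul (2 * (Real.pi : ℂ))⁻¹).congr (Filter.Eventually.of_forall fun τ => ?_)
    simp only [intFourier]
    ring
  · have := integral_integral_swap (f := fun (p : Torus × ℝ) (τ : ℝ) =>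
      fourier (-n) p.1 * f p * Complex.exp (-(Complex.I * p.2 * τ)) * φ τ) hint
    simp only [e1, e2] at this
    rw [this, ← integral_const_mul]
    congr 1
    ext τ
    simp only [intFourier]
    ring

/-! ### The Fourier transform on `L²(ℝ)` -/

open FourierTransform in
/-- The multiplication formula for the Fourier transform on `L²(ℝ)`. -/
theorem integral_fourier_mul_schwartz (a : Lp ℂ 2 (volume : Measure ℝ)) (ψ : 𝓢(ℝ, ℂ)) :
    ∫ ξ, (𝓕 a : Lp ℂ 2 (volume : Measure ℝ)) ξ * ψ ξ = ∫ t, a t * (𝓕 ψ) t := by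
  have h := DFunLike.congr_fun (Lp.fourier_toTemperedDistribution_eq a) ψ
  rw [TemperedDistribution.fourier_apply, Lp.toTemperedDistribution_apply,
    Lp.toTemperedDistribution_apply] at h
  simpa only [smul_eq_mul, mul_comm] using h.symm

theorem continuous_integral_mul_Lp {g : ℝ → ℂ} (hg : MemLp g 2) :
    Continuous fun b : Lp ℂ 2 (volume : Measure ℝ) => ∫ t, g t * b t := by
  have hg' : MemLp (fun t => starRingEnd ℂ (g t)) 2 := hg.star
  have : (fun b : Lp ℂ 2 (volume : Measure ℝ) => ∫ t, g t * b t) =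
      fun b => inner ℂ (hg'.toLp _) b := by
    ext b
    rw [L2.inner_def]
    refine integral_congr_ae ?_
    filter_upwards [hg'.coeFn_toLp] with t ht
    rw [ht]
    simp [mul_comm]
  rw [this]
  exact continuous_const.inner continuous_id

theorem memLp_comp_sub_left {g : ℝ → ℂ} (hg : MemLp g 2) (ξ : ℝ) :
    MemLp (fun y => g (ξ - y)) 2 :=
  hg.comp_measurePreserving (Measure.measurePreserving_sub_left volume ξ)

theorem memLp_mul_cexp {g : ℝ → ℂ} (hg : MemLp g 2) (τ : ℝ) :
    MemLp (fun t => g t * Complex.exp (-(Complex.I * t * τ))) 2 := by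
  refine hg.of_le (hg.1.mul (by fun_prop)) (Filter.Eventually.of_forall fun t => ?_)
  rw [norm_mul, norm_cexp_neg_I_mul, mul_one]

open FourierTransform in
/-- The Fourier transform turns products of square integrable functions into convolutions. Both
sides are continuous in `b`, and for a Schwartz function `b` the modulated function
`t ↦ b t e^{-2πitξ}` is the Fourier transform of `η ↦ 𝓕 b (ξ - η)`. -/
theorem integral_mul_mul_cexp_eq_convolution (a b : Lp ℂ 2 (volume : Measure ℝ)) (ξ : ℝ) :
    ∫ t : ℝ, a t * b t * Complex.exp (-(Complex.I * t * (2 * Real.pi * ξ : ℝ))) =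
      ∫ η, (𝓕 a : Lp ℂ 2 (volume : Measure ℝ)) η * (𝓕 b : Lp ℂ 2 (volume : Measure ℝ)) (ξ - η) := by
  have hrhs : ∀ b : Lp ℂ 2 (volume : Measure ℝ),
      ∫ η, (𝓕 a : Lp ℂ 2 (volume : Measure ℝ)) η * (𝓕 b : Lp ℂ 2 (volume : Measure ℝ)) (ξ - η) =
      ∫ η, (𝓕 a : Lp ℂ 2 (volume : Measure ℝ)) (ξ - η) * (𝓕 b : Lp ℂ 2 (volume : Measure ℝ)) η := by
    intro b
    rw [← integral_sub_left_eq_self _ volume ξ]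
    simp
  have hlhs : ∀ b : Lp ℂ 2 (volume : Measure ℝ),
      ∫ t : ℝ, a t * b t * Complex.exp (-(Complex.I * t * (2 * Real.pi * ξ : ℝ))) =
      ∫ t : ℝ, a t * Complex.exp (-(Complex.I * t * (2 * Real.pi * ξ : ℝ))) * b t := by
    intro b
    congr 1
    ext t
    ring
  refine DenseRange.induction_on
    (p := fun b : Lp ℂ 2 (volume : Measure ℝ) =>
      ∫ t : ℝ, a t * b t * Complex.exp (-(Complex.I * t * (2 * Real.pi * ξ : ℝ))) =
      ∫ η, (𝓕 a : Lp ℂ 2 (volume : Measure ℝ)) η *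
        (𝓕 b : Lp ℂ 2 (volume : Measure ℝ)) (ξ - η))
    (SchwartzMap.denseRange_toLpCLM (p := 2) ENNReal.ofNat_ne_top) b ?_ ?_
  · simp only [hrhs, hlhs]
    refine isClosed_eq (continuous_integral_mul_Lp (memLp_mul_cexp (Lp.memLp a) _)) ?_
    exact (continuous_integral_mul_Lp (memLp_comp_sub_left (Lp.memLp _) ξ)).comp
      (Lp.fourierTransformₗᵢ ℝ ℂ).continuous
  · intro b
    let e : ℝ ≃L[ℝ] ℝ := ContinuousLinearEquiv.neg ℝ
    let ψ : 𝓢(ℝ, ℂ) := SchwartzMap.compSubConstCLM ℝ (E := ℝ) (F := ℂ) ξ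
      (SchwartzMap.compCLMOfContinuousLinearEquiv ℝ e (𝓕 b))
    have hψ : ∀ η, ψ η = (𝓕 b) (ξ - η) := by
      intro η
      simp [ψ, e]
    have hFψ : ∀ t : ℝ, (𝓕 ψ) t = b t * Complex.exp (-(Complex.I * t * (2 * Real.pi * ξ : ℝ))) := by
      intro t
      rw [SchwartzMap.fourier_coe, Real.fourier_real_eq_integral_exp_smul]
      simp only [hψ]
      rw [← integral_sub_left_eq_self _ volume ξ]
      have hb : b t = ∫ y, Complex.exp (((2 * Real.pi * y * t : ℝ) : ℂ) * Complex.I) • (𝓕 b) y := by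
        have : b t = (𝓕⁻ (𝓕 b)) t := by simp
        rw [this, SchwartzMap.fourierInv_coe, Real.fourierInv_eq']
        congr 1
        ext y
        congr 3
        simp
        ring
      rw [hb, ← integral_mul_const]
      congr 1
      ext y
      simp only [sub_sub_cancel, smul_eq_mul]
      rw [mul_right_comm (Complex.exp _), ← Complex.exp_add]
      congr 2
      push_cast
      ring
    have h := integral_fourier_mul_schwartz a ψ
    simp only [hψ, hFψ] at h
    have h1 : ∫ t : ℝ, a t * (SchwartzMap.toLpCLM ℝ ℂ 2 volume b : Lp ℂ 2 (volume : Measure ℝ)) t *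
        Complex.exp (-(Complex.I * t * (2 * Real.pi * ξ : ℝ))) =
        ∫ t : ℝ, a t * (b t * Complex.exp (-(Complex.I * t * (2 * Real.pi * ξ : ℝ)))) := by
      refine integral_congr_ae ?_
      filter_upwards [b.coeFn_toLp 2 volume] with t ht
      rw [SchwartzMap.toLpCLM_apply, ht, mul_assoc]
    rw [h1, ← h, SchwartzMap.toLpCLM_apply, SchwartzMap.toLp_fourier_eq]
    refine integral_congr_ae ?_
    have := (Measure.measurePreserving_sub_left volume ξ).quasiMeasurePreserving.ae
      ((𝓕 b).coeFn_toLp 2 volume)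
    filter_upwards [this] with η hη
    rw [hη]

open FourierTransform in
/-- The Fourier transform on `L²(ℝ)` in the normalization `∫ e^{-itτ} a(t) dt`. -/
noncomputable def lineFourier (a : Lp ℂ 2 (volume : Measure ℝ)) (τ : ℝ) : ℂ :=
  (𝓕 a : Lp ℂ 2 (volume : Measure ℝ)) (τ / (2 * Real.pi))

theorem measurable_lineFourier (a : Lp ℂ 2 (volume : Measure ℝ)) : Measurable (lineFourier a) :=
  (Lp.stronglyMeasurable _).measurable.comp (measurable_id.div_const _)

theorem memLp_lineFourier (a : Lp ℂ 2 (volume : Measure ℝ)) : MemLp (lineFourier a) 2 := by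
  rw [memLp_two_iff_integrable_sq_norm (measurable_lineFourier a).aestronglyMeasurable]
  have := (memLp_two_iff_integrable_sq_norm (Lp.aestronglyMeasurable _)).1
    (Lp.memLp (Lp.fourierTransformₗᵢ ℝ ℂ a))
  exact this.comp_div (by positivity)

open FourierTransform in
/-- The two normalizations of the Fourier transform differ by a dilation by `2π`. -/
theorem exists_testFourier_eq (φ : 𝓢(ℝ, ℂ)) : ∃ ψ : 𝓢(ℝ, ℂ),
    (∀ ξ, ψ ξ = φ (2 * Real.pi * ξ)) ∧ ∀ t, testFourier φ t = 2 * Real.pi * (𝓕 ψ) t := by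
  let e : ℝ ≃L[ℝ] ℝ :=
    ContinuousLinearEquiv.unitsEquivAut ℝ (Units.mk0 (2 * Real.pi) (by positivity))
  let ψ : 𝓢(ℝ, ℂ) := SchwartzMap.compCLMOfContinuousLinearEquiv ℝ e φ
  have hψ : ∀ ξ, ψ ξ = φ (2 * Real.pi * ξ) := by
    intro ξ
    simp [ψ, e, mul_comm]
  refine ⟨ψ, hψ, fun t => ?_⟩
  rw [SchwartzMap.fourier_coe, Real.fourier_real_eq_integral_exp_smul, testFourier]
  simp only [hψ]
  have := Measure.integral_comp_mul_left
    (fun τ : ℝ => Complex.exp (-(Complex.I * t * τ)) * φ τ) (2 * Real.pi)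
  rw [abs_of_pos (by positivity)] at this
  have e1 : ∫ (v : ℝ), Complex.exp (↑(-2 * Real.pi * v * t) * Complex.I) • φ (2 * Real.pi * v) =
      ∫ x : ℝ, Complex.exp (-(Complex.I * ↑t * ↑(2 * Real.pi * x))) * φ (2 * Real.pi * x) := by
    congr 1
    ext v
    rw [smul_eq_mul]
    congr 2
    push_cast
    ring
  rw [e1, this, Complex.real_smul, ← mul_assoc]
  push_cast
  rw [mul_inv_cancel₀ (by simp [Real.pi_ne_zero]), one_mul]

theorem memLp_testFourier (φ : 𝓢(ℝ, ℂ)) : MemLp (testFourier φ) 2 := by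
  obtain ⟨ψ, -, h⟩ := exists_testFourier_eq φ
  rw [show testFourier φ = fun t => _ from funext h]
  exact (SchwartzMap.memLp _ 2 volume).const_mul _

theorem integral_lineFourier_mul_schwartz (a : Lp ℂ 2 (volume : Measure ℝ)) (φ : 𝓢(ℝ, ℂ)) :
    ∫ τ, lineFourier a τ * φ τ = ∫ t, a t * testFourier φ t := by
  obtain ⟨ψ, hψ, h⟩ := exists_testFourier_eq φ
  have h2 := Measure.integral_comp_mul_left (fun τ : ℝ => lineFourier a τ * φ τ) (2 * Real.pi)
  rw [abs_of_pos (by positivity)] at h2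
  have h3 := integral_fourier_mul_schwartz a ψ
  have hpi : (2 * (Real.pi : ℂ)) ≠ 0 := by simp [Real.pi_ne_zero]
  have e1 : ∀ ξ, lineFourier a (2 * Real.pi * ξ) * φ (2 * Real.pi * ξ) =
      (Lp.fourierTransformₗᵢ ℝ ℂ a) ξ * ψ ξ := by
    intro ξ
    rw [hψ, lineFourier, mul_div_cancel_left₀ _ (by positivity)]
    rfl
  simp only [e1] at h2
  have h4 : ∫ τ, lineFourier a τ * φ τ =
      2 * Real.pi * ∫ ξ, (Lp.fourierTransformₗᵢ ℝ ℂ a) ξ * ψ ξ := by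
    rw [h2, Complex.real_smul, ← mul_assoc]
    push_cast
    rw [mul_inv_cancel₀ hpi, one_mul]
  rw [h4]
  refine (congrArg _ h3).trans ?_
  rw [← integral_const_mul]
  congr 1
  ext t
  rw [h]
  ring

theorem integral_mul_mul_cexp (a b : Lp ℂ 2 (volume : Measure ℝ)) (τ : ℝ) :
    ∫ t : ℝ, a t * b t * Complex.exp (-(Complex.I * t * τ)) =
      (2 * (Real.pi : ℂ))⁻¹ * ∫ σ, lineFourier a σ * lineFourier b (τ - σ) := by
  have h := integral_mul_mul_cexp_eq_convolution a b (τ / (2 * Real.pi))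
  rw [mul_div_cancel₀ _ (by positivity)] at h
  rw [h]
  have h2 := Measure.integral_comp_mul_left
    (fun σ : ℝ => lineFourier a σ * lineFourier b (τ - σ)) (2 * Real.pi)
  rw [abs_of_pos (by positivity), Complex.real_smul] at h2
  push_cast at h2
  rw [← h2]
  congr 1
  ext ξ
  rw [lineFourier, lineFourier, mul_div_cancel_left₀ _ (by positivity), sub_div,
    mul_div_cancel_left₀ _ (by positivity)]

/-! ### The space-time Fourier transform of square integrable functions and their products -/

open AddCircle

/-- The `n`-th Fourier coefficient in the space variable, as a function of time. -/
noncomputable def spaceCoeff (u : Torus × ℝ → ℂ) (n : ℤ) (t : ℝ) : ℂ :=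
  fourierCoeff (fun x => u (x, t)) n

theorem spaceCoeff_eq (u : Torus × ℝ → ℂ) (n : ℤ) (t : ℝ) :
    spaceCoeff u n t = (2 * (Real.pi : ℂ))⁻¹ * ∫ x : Torus, fourier (-n) x * u (x, t) := by
  rw [spaceCoeff, fourierCoeff, integral_haarAddCircle, Complex.real_smul]
  simp

theorem aestronglyMeasurable_spaceCoeff {u : Torus × ℝ → ℂ} (hu : AEStronglyMeasurable u)
    (n : ℤ) : AEStronglyMeasurable (spaceCoeff u n) := by
  rw [show spaceCoeff u n = fun t => _ from funext (spaceCoeff_eq u n)]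
  refine AEStronglyMeasurable.const_mul ?_ _
  have h : AEStronglyMeasurable (fun p : ℝ × Torus => fourier (-n) p.2 * u (p.2, p.1))
      (volume.prod volume) := by
    refine AEStronglyMeasurable.mul ?_ ?_
    · refine Continuous.aestronglyMeasurable ?_
      have := (fourier (T := 2 * Real.pi) (-n)).continuous
      fun_prop
    · exact AEStronglyMeasurable.prod_swap hu
  exact h.integral_prod_right'

theorem ae_memLp_slice {u : Torus × ℝ → ℂ} (hu : MemLp u 2) :
    ∀ᵐ t : ℝ, MemLp (fun x => u (x, t)) 2 haarAddCircle := by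
  have h1 : Integrable (fun p => ‖u p‖ ^ 2) (volume.prod volume) :=
    (memLp_two_iff_integrable_sq_norm hu.1).1 hu
  have h2 : AEStronglyMeasurable (fun p : ℝ × Torus => u p.swap) (volume.prod volume) :=
    AEStronglyMeasurable.prod_swap hu.1
  filter_upwards [h1.prod_left_ae, h2.prodMk_left] with t ht1 ht2
  exact ((memLp_two_iff_integrable_sq_norm ht2).2 ht1).haarAddCircle

theorem hasSum_norm_sq_fourierCoeff {f : Torus → ℂ} (hf : MemLp f 2 haarAddCircle) :
    HasSum (fun n => ‖fourierCoeff f n‖ ^ 2) (∫ x, ‖f x‖ ^ 2 ∂haarAddCircle) := by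
  have h := hasSum_sq_fourierCoeff (hf.toLp f)
  simp only [fourierCoeff_congr_ae hf.coeFn_toLp] at h
  convert! h using 1
  refine integral_congr_ae ?_
  filter_upwards [hf.coeFn_toLp] with x hx
  rw [hx]

/-- Parseval: the Fourier coefficients of a product are the convolution of those of the factors. -/
theorem hasSum_fourierCoeff_mul {f g : Torus → ℂ} (hf : MemLp f 2 haarAddCircle)
    (hg : MemLp g 2 haarAddCircle) (n : ℤ) :
    HasSum (fun m => fourierCoeff f m * fourierCoeff g (n - m))
      (fourierCoeff (fun x => f x * g x) n) := by
  have hF : MemLp (fun x => starRingEnd ℂ (fourier (-n) x * g x)) 2 haarAddCircle := by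
    refine MemLp.of_le hg ?_ (Filter.Eventually.of_forall fun x => ?_)
    · refine Complex.continuous_conj.comp_aestronglyMeasurable (AEStronglyMeasurable.mul ?_ hg.1)
      exact (fourier (T := 2 * Real.pi) (-n)).continuous.aestronglyMeasurable
    · rw [RCLike.norm_conj, norm_mul, norm_fourier_apply, one_mul]
  have h := fourierBasis.hasSum_inner_mul_inner (hF.toLp _) (hf.toLp f)
  convert! h using 1
  · ext m
    rw [mul_comm]
    congr 1
    · rw [fourierCoeff, L2.inner_def, coe_fourierBasis]
      refine integral_congr_ae ?_
      filter_upwards [hF.coeFn_toLp, coeFn_fourierLp (T := 2 * Real.pi) 2 m] with x hx1 hx2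
      rw [hx1, hx2, RCLike.inner_apply, RCLike.conj_conj, smul_eq_mul, ← mul_assoc, ← fourier_add]
      congr 3
      ring
    · rw [← fourierBasis.repr_apply_apply, fourierBasis_repr, fourierCoeff_congr_ae hf.coeFn_toLp]
  · rw [fourierCoeff, L2.inner_def]
    refine integral_congr_ae ?_
    filter_upwards [hF.coeFn_toLp, hf.coeFn_toLp] with x hx1 hx2
    rw [hx1, hx2, RCLike.inner_apply, RCLike.conj_conj, smul_eq_mul]
    ring

theorem integrable_integral_norm_sq {u : Torus × ℝ → ℂ} (hu : MemLp u 2) :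
    Integrable (fun t => ∫ x, ‖u (x, t)‖ ^ 2 ∂haarAddCircle) := by
  have h1 : Integrable (fun p => ‖u p‖ ^ 2) (volume.prod volume) :=
    (memLp_two_iff_integrable_sq_norm hu.1).1 hu
  simp only [integral_haarAddCircle]
  exact h1.integral_prod_right.smul ((2 * Real.pi)⁻¹ : ℝ)

theorem tsum_lintegral_spaceCoeff_lt_top {u : Torus × ℝ → ℂ} (hu : MemLp u 2) :
    ∑' n, ∫⁻ t, ‖spaceCoeff u n t‖ₑ ^ 2 < ∞ := by
  rw [← lintegral_tsum fun n => (aestronglyMeasurable_spaceCoeff hu.1 n).enorm.pow_const 2]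
  refine lt_of_le_of_lt (lintegral_mono_ae ?_) (integrable_integral_norm_sq hu).lintegral_lt_top
  filter_upwards [ae_memLp_slice hu] with t ht
  have h := hasSum_norm_sq_fourierCoeff ht
  rw [← h.tsum_eq, ENNReal.ofReal_tsum_of_nonneg (fun n => by positivity) h.summable]
  refine ENNReal.tsum_le_tsum fun n => le_of_eq ?_
  rw [ENNReal.ofReal_pow (norm_nonneg _), ofReal_norm]
  rfl

theorem memLp_spaceCoeff {u : Torus × ℝ → ℂ} (hu : MemLp u 2) (n : ℤ) :
    MemLp (spaceCoeff u n) 2 := by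
  rw [memLp_two_iff_integrable_sq_norm (aestronglyMeasurable_spaceCoeff hu.1 n)]
  refine (integrable_integral_norm_sq hu).mono'
    ((aestronglyMeasurable_spaceCoeff hu.1 n).norm.pow 2) ?_
  filter_upwards [ae_memLp_slice hu] with t ht
  rw [Real.norm_of_nonneg (by positivity)]
  exact le_hasSum (hasSum_norm_sq_fourierCoeff ht) n fun _ _ => by positivity

/-- The space-time Fourier transform of a square integrable function: Fourier coefficients in
space followed by the `L²` Fourier transform in time. -/
noncomputable def l2Fourier {u : Torus × ℝ → ℂ} (hu : MemLp u 2) (n : ℤ) : ℝ → ℂ :=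
  lineFourier ((memLp_spaceCoeff hu n).toLp _)

theorem hasFourier_l2Fourier {u : Torus × ℝ → ℂ} (hu : MemLp u 2) :
    HasFourier u (l2Fourier hu) := by
  intro n φ
  have hint : Integrable (fun p : Torus × ℝ => fourier (-n) p.1 * u p * testFourier φ p.2) := by
    have h1 : MemLp (fun p : Torus × ℝ => testFourier φ p.2) 2 (volume.prod volume) :=
      (memLp_testFourier φ).comp_snd volume
    have h2 := (MemLp.integrable_mul hu h1).bdd_mul (c := 1)
      (f := fun p : Torus × ℝ => fourier (-n) p.1)
      (by
        refine Continuous.aestronglyMeasurable ?_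
        have := (fourier (T := 2 * Real.pi) (-n)).continuous
        fun_prop)
      (Filter.Eventually.of_forall fun p => (norm_fourier_apply _ _).le)
    refine h2.congr (Filter.Eventually.of_forall fun p => ?_)
    simp only [Pi.mul_apply]
    ring
  refine ⟨MemLp.integrable_mul (memLp_lineFourier _) (SchwartzMap.memLp φ 2 volume), hint, ?_⟩
  rw [l2Fourier, integral_lineFourier_mul_schwartz,
    show (volume : Measure (Torus × ℝ)) = volume.prod volume from rfl,
    integral_prod_symm _ hint, ← integral_const_mul]
  refine integral_congr_ae ?_
  filter_upwards [(memLp_spaceCoeff hu n).coeFn_toLp] with t ht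
  rw [ht, spaceCoeff_eq, integral_mul_const, mul_assoc]

/-- The Fourier transform of a product of square integrable functions is dominated by the
convolution of the absolute values of their Fourier transforms. -/
theorem enorm_intFourier_mul_le {u v : Torus × ℝ → ℂ} (hu : MemLp u 2) (hv : MemLp v 2)
    (n : ℤ) (τ : ℝ) :
    ‖intFourier (fun p => u p * v p) n τ‖ₑ ≤
      ∑' m, ∫⁻ σ, ‖l2Fourier hu m σ‖ₑ * ‖l2Fourier hv (n - m) (τ - σ)‖ₑ := by
  have huv : Integrable (fun p => u p * v p) (volume.prod volume) := MemLp.integrable_mul hu hv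
  have hint : Integrable (fun p : Torus × ℝ =>
      fourier (-n) p.1 * (u p * v p) * Complex.exp (-(Complex.I * p.2 * τ)))
      (volume.prod volume) := by
    refine (huv.bdd_mul (c := 1) (f := fun p : Torus × ℝ =>
        fourier (-n) p.1 * Complex.exp (-(Complex.I * p.2 * τ))) ?_ ?_).congr
        (Filter.Eventually.of_forall fun p => ?_)
    · refine Continuous.aestronglyMeasurable ?_
      have := (fourier (T := 2 * Real.pi) (-n)).continuous
      fun_prop
    · refine Filter.Eventually.of_forall fun q => ?_
      rw [norm_mul, norm_fourier_apply, norm_cexp_neg_I_mul, one_mul]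
    · ring
  have e1 : intFourier (fun p => u p * v p) n τ =
      ∫ t, ∑' m, spaceCoeff u m t * spaceCoeff v (n - m) t *
        Complex.exp (-(Complex.I * t * τ)) := by
    rw [intFourier, show (volume : Measure (Torus × ℝ)) = volume.prod volume from rfl,
      integral_prod_symm _ hint, ← integral_const_mul]
    refine integral_congr_ae ?_
    filter_upwards [ae_memLp_slice hu, ae_memLp_slice hv] with t ht1 ht2
    rw [integral_mul_const, ← mul_assoc, ← spaceCoeff_eq (fun p => u p * v p) n t, tsum_mul_right]
    congr 1
    exact (hasSum_fourierCoeff_mul ht1 ht2 n).tsum_eq.symm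
  rw [e1, integral_tsum]
  · refine enorm_tsum_le_tsum_enorm.trans (ENNReal.tsum_le_tsum fun m => ?_)
    have e2 : ∫ t, spaceCoeff u m t * spaceCoeff v (n - m) t * Complex.exp (-(Complex.I * t * τ)) =
        (2 * (Real.pi : ℂ))⁻¹ * ∫ σ, l2Fourier hu m σ * l2Fourier hv (n - m) (τ - σ) := by
      rw [l2Fourier, l2Fourier, ← integral_mul_mul_cexp]
      refine integral_congr_ae ?_
      filter_upwards [(memLp_spaceCoeff hu m).coeFn_toLp,
        (memLp_spaceCoeff hv (n - m)).coeFn_toLp] with t ht1 ht2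
      rw [ht1, ht2]
    rw [e2, enorm_mul]
    have hpi : ‖(2 * (Real.pi : ℂ))⁻¹‖ₑ ≤ 1 := by
      rw [← ofReal_norm, ENNReal.ofReal_le_one]
      rw [norm_inv, norm_mul, Complex.norm_real, Real.norm_of_nonneg Real.pi_nonneg]
      refine inv_le_one_of_one_le₀ ?_
      have := Real.pi_gt_three
      norm_num
      linarith
    refine (mul_le_of_le_one_left' hpi).trans ?_
    refine (enorm_integral_le_lintegral_enorm _).trans (le_of_eq ?_)
    simp only [enorm_mul]
  · intro m
    refine ((aestronglyMeasurable_spaceCoeff hu.1 m).mul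
      (aestronglyMeasurable_spaceCoeff hv.1 (n - m))).mul ?_
    exact Continuous.aestronglyMeasurable (by fun_prop)
  · have hb : ∀ m, ∫⁻ t, ‖spaceCoeff u m t * spaceCoeff v (n - m) t *
        Complex.exp (-(Complex.I * t * τ))‖ₑ ≤
        (∫⁻ t, ‖spaceCoeff u m t‖ₑ ^ 2) + ∫⁻ t, ‖spaceCoeff v (n - m) t‖ₑ ^ 2 := by
      intro m
      rw [← lintegral_add_left' ((aestronglyMeasurable_spaceCoeff hu.1 m).enorm.pow_const 2)]
      refine lintegral_mono fun t => ?_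
      have : ‖Complex.exp (-(Complex.I * t * τ))‖ₑ = 1 := by
        rw [← ofReal_norm, norm_cexp_neg_I_mul, ENNReal.ofReal_one]
      rw [enorm_mul, enorm_mul, this, mul_one]
      rcases le_total ‖spaceCoeff u m t‖ₑ ‖spaceCoeff v (n - m) t‖ₑ with h | h
      · exact (mul_le_mul_left h _).trans ((pow_two _).symm.le.trans le_add_self)
      · exact (mul_le_mul_right h _).trans ((pow_two _).symm.le.trans le_self_add)
    refine ne_top_of_le_ne_top ?_ (ENNReal.tsum_le_tsum hb)
    have e3 := (Equiv.subLeft n).tsum_eq (fun m => ∫⁻ t, ‖spaceCoeff v m t‖ₑ ^ 2)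
    simp only [Equiv.subLeft_apply] at e3
    rw [ENNReal.tsum_add, e3]
    exact ENNReal.add_ne_top.2 ⟨(tsum_lintegral_spaceCoeff_lt_top hu).ne,
      (tsum_lintegral_spaceCoeff_lt_top hv).ne⟩

theorem measurable_l2Fourier {u : Torus × ℝ → ℂ} (hu : MemLp u 2) (n : ℤ) :
    Measurable (l2Fourier hu n) :=
  measurable_lineFourier _

/-! ### Cauchy–Schwarz and Schur tests for weighted convolutions -/

section Schur

variable {α : Type*} [MeasurableSpace α] {μ : Measure α}

/-- The Cauchy–Schwarz inequality, squared. -/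
theorem sq_lintegral_mul_le {f g : α → ℝ≥0∞} (hf : Measurable f) (hg : Measurable g) :
    (∫⁻ x, f x * g x ∂μ) ^ 2 ≤ (∫⁻ x, f x ^ 2 ∂μ) * ∫⁻ x, g x ^ 2 ∂μ := by
  have h := ENNReal.lintegral_mul_le_Lp_mul_Lq μ Real.HolderConjugate.two_two
    hf.aemeasurable hg.aemeasurable
  have h2 := pow_le_pow_left' h 2
  simp only [Pi.mul_apply, mul_pow] at h2
  refine h2.trans (le_of_eq ?_)
  simp only [← ENNReal.rpow_natCast, ← ENNReal.rpow_mul]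
  norm_num

/-- An `L²` bound by duality. The test function is a truncation of `T`, so that finiteness of the
`L²` norm of `T` is not presupposed. -/
theorem lintegral_sq_le_of_duality [SigmaFinite μ] {T : α → ℝ≥0∞} (hT : Measurable T) {A : ℝ≥0∞}
    (h : ∀ g : α → ℝ≥0∞, Measurable g → (∫⁻ x, T x * g x ∂μ) ^ 2 ≤ A * ∫⁻ x, g x ^ 2 ∂μ) :
    ∫⁻ x, T x ^ 2 ∂μ ≤ A := by
  let S := spanningSets μ
  let g : ℕ → α → ℝ≥0∞ := fun N => (S N).indicator fun x => min (T x) N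
  have hg : ∀ N, Measurable (g N) := fun N =>
    (hT.min measurable_const).indicator (measurableSet_spanningSets μ N)
  have hmono : Monotone fun N x => g N x ^ 2 := by
    intro N N' hN x
    refine pow_le_pow_left' ?_ 2
    refine (Set.indicator_le_indicator_of_subset (monotone_spanningSets μ hN)
      (fun _ => zero_le) x).trans ?_
    refine Set.indicator_le_indicator ?_
    exact min_le_min_left _ (by exact_mod_cast hN)
  have hle : ∀ N x, g N x ≤ T x := fun N x =>
    Set.indicator_apply_le' (fun _ => min_le_left _ _) fun _ => zero_le
  have hsup : ∀ x, T x ^ 2 = ⨆ N, g N x ^ 2 := by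
    intro x
    refine le_antisymm ?_ (iSup_le fun N => pow_le_pow_left' (hle N x) 2)
    obtain ⟨N₀, hN₀⟩ : ∃ N, x ∈ S N := by
      have := iUnion_spanningSets μ
      exact Set.mem_iUnion.1 (this ▸ Set.mem_univ x)
    have hin : ∀ N, N₀ ≤ N → g N x = min (T x) N := fun N hN =>
      Set.indicator_of_mem (monotone_spanningSets μ hN hN₀) _
    refine le_of_tendsto_of_tendsto (b := Filter.atTop) (f := fun N : ℕ => (min (T x) N) ^ 2)
      ?_ tendsto_const_nhds ?_
    · have h1 : Filter.Tendsto (fun N : ℕ => min (T x) (N : ℝ≥0∞)) Filter.atTop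
          (nhds (min (T x) ⊤)) := tendsto_const_nhds.min ENNReal.tendsto_nat_nhds_top
      rw [min_top_right] at h1
      exact ((ENNReal.continuous_pow 2).tendsto _).comp h1
    · filter_upwards [Filter.eventually_ge_atTop N₀] with N hN
      rw [← hin N hN]
      exact le_iSup (fun N => g N x ^ 2) N
  have hbound : ∀ N, ∫⁻ x, g N x ^ 2 ∂μ ≤ A := by
    intro N
    have hfin : ∫⁻ x, g N x ^ 2 ∂μ ≠ ∞ := by
      have : ∫⁻ x, g N x ^ 2 ∂μ ≤ ∫⁻ x, (S N).indicator (fun _ => (N : ℝ≥0∞) ^ 2) x ∂μ := by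
        refine lintegral_mono fun x => ?_
        by_cases hx : x ∈ S N
        · simp only [g, Set.indicator_of_mem hx]
          exact pow_le_pow_left' (min_le_right _ _) 2
        · simp [g, Set.indicator_of_notMem hx]
      refine ne_top_of_le_ne_top ?_ this
      rw [lintegral_indicator (measurableSet_spanningSets μ N), setLIntegral_const]
      exact ENNReal.mul_ne_top (by finiteness) (measure_spanningSets_lt_top μ N).ne
    have h1 : (∫⁻ x, g N x ^ 2 ∂μ) ^ 2 ≤ A * ∫⁻ x, g N x ^ 2 ∂μ := by
      refine le_trans (pow_le_pow_left' (lintegral_mono fun x => ?_) 2) (h (g N) (hg N))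
      rw [pow_two]
      exact mul_le_mul_left (hle N x) _
    rcases eq_or_ne (∫⁻ x, g N x ^ 2 ∂μ) 0 with h0 | h0
    · rw [h0]
      exact zero_le
    · rw [pow_two] at h1
      exact (ENNReal.mul_le_mul_iff_left h0 hfin).1 h1
  rw [lintegral_congr hsup, lintegral_iSup (fun N => (hg N).pow_const 2) hmono]
  exact iSup_le hbound

end Schur

section Convolution

theorem lintegral_comp_sub_right {G : Type*} [AddCommGroup G] [MeasurableSpace G]
    [MeasurableAdd₂ G] {μ : Measure G} [μ.IsAddLeftInvariant] (g : G → ℝ≥0∞) (w : G) :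
    ∫⁻ z, g (z - w) ∂μ = ∫⁻ z, g z ∂μ := by
  simp only [sub_eq_add_neg]
  exact lintegral_add_right_eq_self _ _

variable {G : Type*} [AddCommGroup G] [MeasurableSpace G] [MeasurableAdd₂ G] [MeasurableNeg G]
  [MeasurableSub₂ G] {μ : Measure G} [SigmaFinite μ] [μ.IsAddLeftInvariant]

/-- Weighted convolution bound when the weight is square integrable along the output variable's
fibres. -/
theorem lintegral_sq_convolution_le_of_output {K : G → G → ℝ≥0∞}
    (hK : Measurable (Function.uncurry K))
    {f g : G → ℝ≥0∞} (hf : Measurable f) (hg : Measurable g) {M : ℝ≥0∞}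
    (hM : ∀ z, ∫⁻ w, K z w ^ 2 ∂μ ≤ M) :
    ∫⁻ z, (∫⁻ w, K z w * (f w * g (z - w)) ∂μ) ^ 2 ∂μ ≤
      M * ((∫⁻ w, f w ^ 2 ∂μ) * ∫⁻ w, g w ^ 2 ∂μ) := by
  calc ∫⁻ z, (∫⁻ w, K z w * (f w * g (z - w)) ∂μ) ^ 2 ∂μ
      ≤ ∫⁻ z, M * ∫⁻ w, (f w * g (z - w)) ^ 2 ∂μ ∂μ := by
        refine lintegral_mono fun z => ?_
        exact (sq_lintegral_mul_le (hK.comp measurable_prodMk_left) (by fun_prop)).trans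
          (mul_le_mul_left (hM z) _)
    _ = M * ∫⁻ w, ∫⁻ z, (f w * g (z - w)) ^ 2 ∂μ ∂μ := by
        rw [lintegral_const_mul _ (by fun_prop), lintegral_lintegral_swap (by fun_prop)]
    _ = _ := by
        congr 1
        rw [← lintegral_mul_const _ (by fun_prop)]
        refine lintegral_congr fun w => ?_
        simp only [mul_pow]
        rw [lintegral_const_mul _ (by fun_prop), lintegral_comp_sub_right (fun z => g z ^ 2)]

variable [μ.IsNegInvariant]

/-- Weighted convolution bound when the weight is square integrable in the output variable, for
every value of the variable of the first factor. -/
theorem lintegral_sq_convolution_le_of_left {K : G → G → ℝ≥0∞}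
    (hK : Measurable (Function.uncurry K))
    {f g : G → ℝ≥0∞} (hf : Measurable f) (hg : Measurable g) {M : ℝ≥0∞}
    (hM : ∀ w, ∫⁻ z, K z w ^ 2 ∂μ ≤ M) :
    ∫⁻ z, (∫⁻ w, K z w * (f w * g (z - w)) ∂μ) ^ 2 ∂μ ≤
      M * ((∫⁻ w, f w ^ 2 ∂μ) * ∫⁻ w, g w ^ 2 ∂μ) := by
  have hK' : Measurable fun p : G × G => K p.1 p.2 := hK
  refine lintegral_sq_le_of_duality (by fun_prop) fun h hh => ?_
  calc (∫⁻ z, (∫⁻ w, K z w * (f w * g (z - w)) ∂μ) * h z ∂μ) ^ 2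
      = (∫⁻ w, f w * ∫⁻ z, K z w * (g (z - w) * h z) ∂μ ∂μ) ^ 2 := by
        congr 1
        have : ∀ z, (∫⁻ w, K z w * (f w * g (z - w)) ∂μ) * h z =
            ∫⁻ w, K z w * (f w * g (z - w)) * h z ∂μ := fun z =>
          (lintegral_mul_const _ (by fun_prop)).symm
        rw [lintegral_congr this, lintegral_lintegral_swap (by fun_prop)]
        refine lintegral_congr fun w => ?_
        rw [← lintegral_const_mul _ (by fun_prop)]
        refine lintegral_congr fun z => ?_
        ring
    _ ≤ (∫⁻ w, f w ^ 2 ∂μ) * ∫⁻ w, (∫⁻ z, K z w * (g (z - w) * h z) ∂μ) ^ 2 ∂μ :=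
        sq_lintegral_mul_le hf (by fun_prop)
    _ ≤ (∫⁻ w, f w ^ 2 ∂μ) * ∫⁻ w, M * ∫⁻ z, (g (z - w) * h z) ^ 2 ∂μ ∂μ := by
        gcongr with w
        exact (sq_lintegral_mul_le (by fun_prop) (by fun_prop)).trans (mul_le_mul_left (hM w) _)
    _ = (∫⁻ w, f w ^ 2 ∂μ) * (M * ((∫⁻ w, g w ^ 2 ∂μ) * ∫⁻ z, h z ^ 2 ∂μ)) := by
        congr 1
        rw [lintegral_const_mul _ (by fun_prop), lintegral_lintegral_swap (by fun_prop)]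
        congr 1
        rw [← lintegral_const_mul _ (by fun_prop)]
        refine lintegral_congr fun z => ?_
        simp only [mul_pow]
        rw [lintegral_mul_const _ (by fun_prop),
          lintegral_sub_left_eq_self (fun w => g w ^ 2) z]
    _ = _ := by ring

/-- Weighted convolution bound when the weight is square integrable in the first variable, for
every value of the variable of the second factor. -/
theorem lintegral_sq_convolution_le_of_right {K : G → G → ℝ≥0∞}
    (hK : Measurable (Function.uncurry K))
    {f g : G → ℝ≥0∞} (hf : Measurable f) (hg : Measurable g) {M : ℝ≥0∞}
    (hM : ∀ y, ∫⁻ w, K (w + y) w ^ 2 ∂μ ≤ M) :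
    ∫⁻ z, (∫⁻ w, K z w * (f w * g (z - w)) ∂μ) ^ 2 ∂μ ≤
      M * ((∫⁻ w, f w ^ 2 ∂μ) * ∫⁻ w, g w ^ 2 ∂μ) := by
  have hK' : Measurable fun p : G × G => K p.1 p.2 := hK
  have h := lintegral_sq_convolution_le_of_left (μ := μ) (K := fun z y => K z (z - y))
    (M := M) (by unfold Function.uncurry; fun_prop) hg hf (fun y => by
      refine le_trans (le_of_eq ?_) (hM y)
      rw [← lintegral_comp_sub_right (fun w => K (w + y) w ^ 2) y]
      simp)
  rw [mul_comm (∫⁻ w, g w ^ 2 ∂μ)] at h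
  refine le_trans (le_of_eq (lintegral_congr fun z => ?_)) h
  rw [← lintegral_sub_left_eq_self _ z]
  congr 1
  refine lintegral_congr fun y => ?_
  rw [sub_sub_cancel, mul_comm (f _)]

end Convolution

instance {G H : Type*} [Neg G] [Neg H] [MeasurableSpace G] [MeasurableSpace H] [MeasurableNeg G]
    [MeasurableNeg H] (μ : Measure G) (ν : Measure H) [SFinite μ] [SFinite ν] [μ.IsNegInvariant]
    [ν.IsNegInvariant] : (μ.prod ν).IsNegInvariant where
  neg_eq_self := by
    have h := Measure.map_prod_map μ ν measurable_neg measurable_neg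
    rw [show Measure.map Neg.neg μ = μ from Measure.neg_eq_self μ,
      show Measure.map Neg.neg ν = ν from Measure.neg_eq_self ν] at h
    exact h.symm

/-! ### Brackets and their powers -/

theorem one_le_bracket (x : ℝ) : 1 ≤ bracket x := by
  unfold bracket
  linarith [abs_nonneg x]

theorem bracket_pos (x : ℝ) : 0 < bracket x := zero_lt_one.trans_le (one_le_bracket x)

theorem bracket_neg (x : ℝ) : bracket (-x) = bracket x := by simp [bracket]

theorem bracket_add_le_mul (x y : ℝ) : bracket (x + y) ≤ bracket x * bracket y := by
  unfold bracket
  nlinarith [abs_add_le x y, abs_nonneg x, abs_nonneg y, mul_nonneg (abs_nonneg x) (abs_nonneg y)]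

theorem bracket_add_le (x y : ℝ) : bracket (x + y) ≤ bracket x + bracket y := by
  unfold bracket
  linarith [abs_add_le x y]

theorem measurable_bracket : Measurable bracket := by
  unfold bracket
  fun_prop

/-- The power `⟨x⟩ ^ a` as an extended nonnegative real. -/
noncomputable def bracketPow (x a : ℝ) : ℝ≥0∞ := ENNReal.ofReal (bracket x ^ a)

@[fun_prop]
theorem measurable_bracketPow {α : Type*} [MeasurableSpace α] {f : α → ℝ} (hf : Measurable f)
    (a : ℝ) : Measurable fun x => bracketPow (f x) a := by
  unfold bracketPow
  exact ((measurable_bracket.comp hf).pow_const a).ennreal_ofReal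

theorem bracketPow_add (x a b : ℝ) : bracketPow x (a + b) = bracketPow x a * bracketPow x b := by
  unfold bracketPow
  rw [← ENNReal.ofReal_mul (by have := bracket_pos x; positivity), Real.rpow_add (bracket_pos x)]

theorem bracketPow_zero (x : ℝ) : bracketPow x 0 = 1 := by simp [bracketPow]

theorem bracketPow_neg_left (x a : ℝ) : bracketPow (-x) a = bracketPow x a := by
  simp [bracketPow, bracket_neg]

theorem bracketPow_mono (x : ℝ) {a b : ℝ} (h : a ≤ b) : bracketPow x a ≤ bracketPow x b :=
  ENNReal.ofReal_le_ofReal (Real.rpow_le_rpow_of_exponent_le (one_le_bracket x) h)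

theorem bracketPow_le_one (x : ℝ) {a : ℝ} (h : a ≤ 0) : bracketPow x a ≤ 1 :=
  (bracketPow_mono x h).trans (bracketPow_zero x).le

theorem bracketPow_sq (x a : ℝ) : bracketPow x a ^ 2 = bracketPow x (2 * a) := by
  rw [pow_two, ← bracketPow_add, two_mul]

theorem lintegral_bracketPow_lt_top {a : ℝ} (ha : a < -1) : ∫⁻ x, bracketPow x a < ∞ := by
  have h := finite_integral_one_add_norm (E := ℝ) (μ := volume) (r := -a) (by simp; linarith)
  simpa [bracketPow, bracket] using h

theorem lintegral_bracketPow_sub (a b : ℝ) :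
    ∫⁻ x, bracketPow (x - b) a = ∫⁻ x, bracketPow x a :=
  lintegral_sub_right_eq_self (fun x => bracketPow x a) b

/-- Two weights with exponents slightly above `-1` convolve to a decaying function. -/
theorem exists_lintegral_bracketPow_mul_le : ∃ C : ℝ≥0∞, C < ∞ ∧ ∀ a b : ℝ,
    ∫⁻ x, bracketPow (x - a) (-(7 / 8)) * bracketPow (x - b) (-(7 / 8)) ≤
      C * bracketPow (a - b) (-(1 / 2)) := by
  have key : ∀ P Q R : ℝ, 1 ≤ P → 1 ≤ Q → 1 ≤ R → R ≤ P + Q → Q ≤ P →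
      P ^ (-(7 / 8) : ℝ) * Q ^ (-(7 / 8) : ℝ) ≤ 2 * R ^ (-(1 / 2) : ℝ) * Q ^ (-(5 / 4) : ℝ) := by
    intro P Q R hP hQ hR h1 h2
    -- Of the exponent of the larger bracket `P ≥ R / 2`, the part `-1/2` yields the decay in `R`,
    -- and the rest is passed to `Q`, which then has the integrable exponent `-5/4`.
    have e1 : P ^ (-(7 / 8) : ℝ) = P ^ (-(1 / 2) : ℝ) * P ^ (-(3 / 8) : ℝ) := by
      rw [← Real.rpow_add (by linarith)]; norm_num
    have e2 : Q ^ (-(5 / 4) : ℝ) = Q ^ (-(3 / 8) : ℝ) * Q ^ (-(7 / 8) : ℝ) := by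
      rw [← Real.rpow_add (by linarith)]; norm_num
    have e3 : P ^ (-(3 / 8) : ℝ) ≤ Q ^ (-(3 / 8) : ℝ) :=
      Real.rpow_le_rpow_of_nonpos (by linarith) h2 (by norm_num)
    have e4 : P ^ (-(1 / 2) : ℝ) ≤ 2 * R ^ (-(1 / 2) : ℝ) := by
      calc P ^ (-(1 / 2) : ℝ) ≤ (R / 2) ^ (-(1 / 2) : ℝ) :=
            Real.rpow_le_rpow_of_nonpos (by linarith) (by linarith) (by norm_num)
        _ = 2 ^ (1 / 2 : ℝ) * R ^ (-(1 / 2) : ℝ) := by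
            rw [div_eq_mul_inv, Real.mul_rpow (by linarith) (by norm_num),
              Real.inv_rpow (by norm_num), ← Real.rpow_neg (by norm_num), neg_neg, mul_comm]
        _ ≤ 2 * R ^ (-(1 / 2) : ℝ) := by
            gcongr
            calc (2 : ℝ) ^ (1 / 2 : ℝ) ≤ 2 ^ (1 : ℝ) :=
                  Real.rpow_le_rpow_of_exponent_le (by norm_num) (by norm_num)
              _ = 2 := Real.rpow_one 2
    rw [e1, e2]
    have := Real.rpow_nonneg (show 0 ≤ P by linarith) (-(3 / 8))
    calc P ^ (-(1 / 2) : ℝ) * P ^ (-(3 / 8) : ℝ) * Q ^ (-(7 / 8) : ℝ)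
        ≤ 2 * R ^ (-(1 / 2) : ℝ) * Q ^ (-(3 / 8) : ℝ) * Q ^ (-(7 / 8) : ℝ) := by gcongr
      _ = _ := by ring
  have pw : ∀ a b x : ℝ, bracketPow (x - a) (-(7 / 8)) * bracketPow (x - b) (-(7 / 8)) ≤
      2 * bracketPow (a - b) (-(1 / 2)) *
        (bracketPow (x - a) (-(5 / 4)) + bracketPow (x - b) (-(5 / 4))) := by
    intro a b x
    have hR : bracket (a - b) ≤ bracket (x - a) + bracket (x - b) := by
      have := bracket_add_le (-(x - a)) (x - b)
      rw [bracket_neg] at this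
      convert! this using 2
      ring
    have pa := bracket_pos (x - a)
    have pb := bracket_pos (x - b)
    have pr := bracket_pos (a - b)
    unfold bracketPow
    rw [← ENNReal.ofReal_mul (by positivity), ← ENNReal.ofReal_add (by positivity) (by positivity),
      show (2 : ℝ≥0∞) = ENNReal.ofReal 2 by simp, ← ENNReal.ofReal_mul (by positivity),
      ← ENNReal.ofReal_mul (by positivity)]
    refine ENNReal.ofReal_le_ofReal ?_
    rw [mul_add]
    rcases le_total (bracket (x - b)) (bracket (x - a)) with h | h
    · refine (key _ _ _ (one_le_bracket _) (one_le_bracket _) (one_le_bracket _) hR h).trans ?_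
      exact le_add_of_nonneg_left (by positivity)
    · rw [mul_comm]
      refine (key _ _ (bracket (a - b)) (one_le_bracket _) (one_le_bracket _) (one_le_bracket _)
        (by linarith) h).trans ?_
      exact le_add_of_nonneg_right (by positivity)
  have hfin := lintegral_bracketPow_lt_top (a := -(5 / 4)) (by norm_num)
  refine ⟨4 * ∫⁻ x, bracketPow x (-(5 / 4)), ENNReal.mul_lt_top (by simp) hfin, fun a b => ?_⟩
  refine (lintegral_mono (pw a b)).trans (le_of_eq ?_)
  rw [lintegral_const_mul _ (by fun_prop), lintegral_add_left (by fun_prop),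
    lintegral_bracketPow_sub, lintegral_bracketPow_sub]
  ring

theorem tsum_int_bracketPow_lt_top {a : ℝ} (ha : a < -1) :
    ∑' m : ℤ, bracketPow m a < ∞ := by
  have h1 : Summable fun n : ℕ => (1 + (n : ℝ)) ^ a := by
    have := (summable_nat_add_iff 1).2 (Real.summable_nat_rpow.2 ha)
    refine this.congr fun n => ?_
    push_cast
    rw [add_comm]
  have h2 : Summable fun m : ℤ => bracket m ^ a := by
    refine Summable.of_nat_of_neg (h1.congr fun n => ?_) (h1.congr fun n => ?_) <;>
    simp [bracket]
  unfold bracketPow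
  rw [← ENNReal.ofReal_tsum_of_nonneg (fun m => by have := bracket_pos m; positivity) h2]
  exact ENNReal.ofReal_lt_top

/-- Sums of `⟨m - ρ⟩ ^ (-3/2)` over the integers are bounded uniformly in `ρ`. -/
theorem exists_tsum_bracketPow_sub_le : ∃ C : ℝ≥0∞, C < ∞ ∧ ∀ ρ : ℝ,
    ∑' m : ℤ, bracketPow (m - ρ) (-(3 / 2)) ≤ C := by
  refine ⟨4 * ∑' m : ℤ, bracketPow m (-(3 / 2)),
    ENNReal.mul_lt_top (by simp) (tsum_int_bracketPow_lt_top (by norm_num)), fun ρ => ?_⟩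
  have e := (Equiv.subRight ⌊ρ⌋).tsum_eq (fun m : ℤ => bracketPow m (-(3 / 2)))
  rw [← e, ← ENNReal.tsum_mul_left]
  refine ENNReal.tsum_le_tsum fun m => ?_
  unfold bracketPow
  rw [show (4 : ℝ≥0∞) = ENNReal.ofReal 4 by simp, ← ENNReal.ofReal_mul (by norm_num)]
  refine ENNReal.ofReal_le_ofReal ?_
  have h1 : bracket ((m - ⌊ρ⌋ : ℤ) : ℝ) / 2 ≤ bracket (m - ρ) := by
    have hfl : |ρ - ⌊ρ⌋| ≤ 1 := by
      rw [abs_le]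
      constructor <;> linarith [Int.floor_le ρ, Int.lt_floor_add_one ρ]
    have := abs_add_le ((m : ℝ) - ρ) (ρ - ⌊ρ⌋)
    rw [sub_add_sub_cancel] at this
    unfold bracket
    push_cast
    linarith [abs_nonneg ((m : ℝ) - ρ)]
  have hp := bracket_pos ((m - ⌊ρ⌋ : ℤ) : ℝ)
  calc bracket (m - ρ) ^ (-(3 / 2) : ℝ) ≤ (bracket ((m - ⌊ρ⌋ : ℤ) : ℝ) / 2) ^ (-(3 / 2) : ℝ) :=
        Real.rpow_le_rpow_of_nonpos (by positivity) h1 (by norm_num)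
    _ = 2 ^ (3 / 2 : ℝ) * bracket ((m - ⌊ρ⌋ : ℤ) : ℝ) ^ (-(3 / 2) : ℝ) := by
        rw [div_eq_mul_inv, Real.mul_rpow hp.le (by norm_num),
          Real.inv_rpow (by norm_num), ← Real.rpow_neg (by norm_num), neg_neg, mul_comm]
    _ ≤ 4 * bracket ((m - ⌊ρ⌋ : ℤ) : ℝ) ^ (-(3 / 2) : ℝ) := by
        gcongr
        calc (2 : ℝ) ^ (3 / 2 : ℝ) ≤ 2 ^ (2 : ℝ) :=
              Real.rpow_le_rpow_of_exponent_le (by norm_num) (by norm_num)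
          _ = 4 := by norm_num

/-! ### Sums over the values of a cubic polynomial -/

theorem exists_roots_of_monic_cubic (b c d : ℝ) : ∃ r₁ r₂ r₃ : ℂ, ∀ x : ℝ,
    ((x ^ 3 + b * x ^ 2 + c * x + d : ℝ) : ℂ) = (x - r₁) * (x - r₂) * (x - r₃) := by
  let P : Cubic ℂ := ⟨1, b, c, d⟩
  obtain ⟨x, y, z, h⟩ := (Cubic.splits_iff_roots_eq_three (P := P) (φ := RingHom.id ℂ)
    one_ne_zero).1 (IsAlgClosed.splits _)
  refine ⟨x, y, z, fun t => ?_⟩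
  have hb : (b : ℂ) = 1 * -(x + y + z) := Cubic.b_eq_three_roots (P := P) one_ne_zero h
  have hc : (c : ℂ) = 1 * (x * y + x * z + y * z) :=
    Cubic.c_eq_three_roots (P := P) one_ne_zero h
  have hd : (d : ℂ) = 1 * -(x * y * z) := Cubic.d_eq_three_roots (P := P) one_ne_zero h
  push_cast
  rw [hb, hc, hd]
  ring

/-- A monic real cubic is at least the cube of the distance to the nearest of three real numbers
(the real parts of its roots). -/
theorem exists_cube_le_abs_cubic (b c d : ℝ) : ∃ ρ₁ ρ₂ ρ₃ : ℝ, ∀ x : ℝ,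
    |x - ρ₁| ^ 3 ≤ |x ^ 3 + b * x ^ 2 + c * x + d| ∨
    |x - ρ₂| ^ 3 ≤ |x ^ 3 + b * x ^ 2 + c * x + d| ∨
    |x - ρ₃| ^ 3 ≤ |x ^ 3 + b * x ^ 2 + c * x + d| := by
  obtain ⟨r₁, r₂, r₃, h⟩ := exists_roots_of_monic_cubic b c d
  refine ⟨r₁.re, r₂.re, r₃.re, fun x => ?_⟩
  have hre : ∀ r : ℂ, |x - r.re| ≤ ‖(x : ℂ) - r‖ := fun r => by
    simpa using Complex.abs_re_le_norm ((x : ℂ) - r)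
  have hp : |x - r₁.re| * |x - r₂.re| * |x - r₃.re| ≤ |x ^ 3 + b * x ^ 2 + c * x + d| := by
    rw [← Real.norm_eq_abs (x ^ 3 + b * x ^ 2 + c * x + d), ← Complex.norm_real, h, norm_mul,
      norm_mul]
    gcongr <;> exact hre _
  have key : ∀ p q r : ℝ, 0 ≤ p → p ≤ q → p ≤ r → p ^ 3 ≤ p * q * r := by
    intro p q r hp hq hr
    calc p ^ 3 = p * p * p := by ring
      _ ≤ p * q * r :=
        mul_le_mul (mul_le_mul_of_nonneg_left hq hp) hr hp (mul_nonneg hp (hp.trans hq))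
  set p := |x - r₁.re|
  set q := |x - r₂.re|
  set r := |x - r₃.re|
  have p0 : 0 ≤ p := abs_nonneg _
  have q0 : 0 ≤ q := abs_nonneg _
  have r0 : 0 ≤ r := abs_nonneg _
  rcases le_total p q with h1 | h1
  · rcases le_total p r with h2 | h2
    · exact Or.inl ((key p q r p0 h1 h2).trans hp)
    · exact Or.inr (Or.inr ((key r p q r0 h2 (h2.trans h1)).trans (le_trans (by linarith) hp)))
  · rcases le_total q r with h2 | h2
    · exact Or.inr (Or.inl ((key q p r q0 h1 h2).trans (le_trans (by linarith) hp)))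
    · exact Or.inr (Or.inr ((key r p q r0 (h2.trans h1) h2).trans (le_trans (by linarith) hp)))

theorem exists_tsum_bracketPow_cubic_le : ∃ C : ℝ≥0∞, C < ∞ ∧ ∀ b c d : ℝ,
    ∑' m : ℤ, bracketPow ((m : ℝ) ^ 3 + b * (m : ℝ) ^ 2 + c * m + d) (-(1 / 2)) ≤ C := by
  obtain ⟨C, hC, h⟩ := exists_tsum_bracketPow_sub_le
  refine ⟨2 * (C + C + C), by finiteness, fun b c d => ?_⟩
  obtain ⟨ρ₁, ρ₂, ρ₃, hρ⟩ := exists_cube_le_abs_cubic b c d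
  have key : ∀ x y : ℝ, |x| ^ 3 ≤ |y| → bracketPow y (-(1 / 2)) ≤ 2 * bracketPow x (-(3 / 2)) := by
    intro x y hxy
    -- `(1 + |x|)³ ≤ 4 (1 + |x|³)`, and `4^{1/2} = 2`.
    unfold bracketPow
    rw [show (2 : ℝ≥0∞) = ENNReal.ofReal 2 by simp, ← ENNReal.ofReal_mul (by norm_num)]
    refine ENNReal.ofReal_le_ofReal ?_
    have hp := bracket_pos x
    have h1 : bracket x ^ 3 / 4 ≤ bracket y := by
      unfold bracket
      nlinarith [abs_nonneg x, mul_nonneg (abs_nonneg x) (sq_nonneg (|x| - 1)),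
        sq_nonneg (|x| - 1)]
    calc bracket y ^ (-(1 / 2) : ℝ) ≤ (bracket x ^ 3 / 4) ^ (-(1 / 2) : ℝ) :=
          Real.rpow_le_rpow_of_nonpos (by positivity) h1 (by norm_num)
      _ = 2 * bracket x ^ (-(3 / 2) : ℝ) := by
          rw [div_eq_mul_inv, Real.mul_rpow (by positivity) (by norm_num), ← Real.rpow_natCast,
            ← Real.rpow_mul hp.le, Real.inv_rpow (by norm_num), ← Real.rpow_neg (by norm_num),
            show (4 : ℝ) = 2 ^ (2 : ℝ) by norm_num, ← Real.rpow_mul (by norm_num)]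
          norm_num
          ring
  calc ∑' m : ℤ, bracketPow ((m : ℝ) ^ 3 + b * (m : ℝ) ^ 2 + c * m + d) (-(1 / 2))
      ≤ ∑' m : ℤ, 2 * (bracketPow (m - ρ₁) (-(3 / 2)) + bracketPow (m - ρ₂) (-(3 / 2)) +
          bracketPow (m - ρ₃) (-(3 / 2))) := by
        refine ENNReal.tsum_le_tsum fun m => ?_
        rcases hρ m with h | h | h
        · refine (key _ _ h).trans (mul_le_mul_right ?_ _)
          exact le_add_right le_self_add
        · refine (key _ _ h).trans (mul_le_mul_right ?_ _)
          exact le_add_right le_add_self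
        · exact (key _ _ h).trans (mul_le_mul_right le_add_self _)
    _ ≤ 2 * (C + C + C) := by
        rw [ENNReal.tsum_mul_left, ENNReal.tsum_add, ENNReal.tsum_add]
        gcongr <;> exact h _

/-! ### Kernels and weights on the frequency space `ℤ × ℝ` -/

/-- Counting measure times Lebesgue measure on the frequency space. -/
noncomputable abbrev freqMeasure : Measure (ℤ × ℝ) := Measure.count.prod volume

theorem lintegral_freqMeasure {f : ℤ × ℝ → ℝ≥0∞} (hf : Measurable f) :
    ∫⁻ z, f z ∂freqMeasure = ∑' n, ∫⁻ τ, f (n, τ) := by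
  rw [lintegral_prod _ hf.aemeasurable, lintegral_count]

@[fun_prop]
theorem measurable_schrodingerPhase : Measurable schrodingerPhase := measurable_of_countable _

@[fun_prop]
theorem measurable_airyPhase : Measurable airyPhase := measurable_of_countable _

@[fun_prop]
theorem measurable_intCast_real : Measurable fun n : ℤ => (n : ℝ) := measurable_of_countable _

/-- The kernel for which the derivative weight is absorbed by the output. -/
noncomputable def kernelOutput (z w : ℤ × ℝ) : ℝ≥0∞ :=
  bracketPow (w.2 - schrodingerPhase w.1) (-(7 / 16)) *
    bracketPow ((z - w).2 - airyPhase (z - w).1) (-(7 / 16))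

/-- The kernel for which the derivative weight is absorbed by the first factor. -/
noncomputable def kernelLeft (z w : ℤ × ℝ) : ℝ≥0∞ :=
  bracketPow (z.2 - schrodingerPhase z.1) (-(7 / 16)) *
    bracketPow ((z - w).2 - airyPhase (z - w).1) (-(7 / 16))

/-- The kernel for which the derivative weight is absorbed by the second factor. -/
noncomputable def kernelRight (z w : ℤ × ℝ) : ℝ≥0∞ :=
  bracketPow w.1 (-1) * (bracketPow (z.2 - schrodingerPhase z.1) (-(7 / 16)) *
    bracketPow (w.2 - schrodingerPhase w.1) (-(7 / 16)))

theorem measurable_kernelOutput : Measurable (Function.uncurry kernelOutput) := by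
  simp only [Function.uncurry_def, kernelOutput]
  fun_prop

theorem measurable_kernelLeft : Measurable (Function.uncurry kernelLeft) := by
  simp only [Function.uncurry_def, kernelLeft]
  fun_prop

theorem measurable_kernelRight : Measurable (Function.uncurry kernelRight) := by
  simp only [Function.uncurry_def, kernelRight]
  fun_prop

/-- With the output frequency fixed, the resonance function is a monic cubic in the frequency of the
first factor. -/
theorem exists_lintegral_kernel_output_le : ∃ C : ℝ≥0∞, C < ∞ ∧ ∀ z : ℤ × ℝ,
    ∫⁻ w, kernelOutput z w ^ 2 ∂freqMeasure ≤ C := by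
  unfold kernelOutput
  obtain ⟨C₁, hC₁, h₁⟩ := exists_lintegral_bracketPow_mul_le
  obtain ⟨C₂, hC₂, h₂⟩ := exists_tsum_bracketPow_cubic_le
  refine ⟨C₁ * C₂, ENNReal.mul_lt_top hC₁ hC₂, fun z => ?_⟩
  obtain ⟨n, τ⟩ := z
  rw [lintegral_freqMeasure (by fun_prop)]
  refine le_trans ?_ (mul_le_mul_right (h₂ (1 - 3 * n) (3 * n ^ 2) (τ - n ^ 3)) C₁)
  rw [← ENNReal.tsum_mul_left]
  refine ENNReal.tsum_le_tsum fun m => ?_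
  refine le_trans (le_of_eq ?_) ((h₁ (schrodingerPhase m) (τ - airyPhase (n - m))).trans
    (le_of_eq ?_))
  · refine lintegral_congr fun σ => ?_
    rw [mul_pow, bracketPow_sq, bracketPow_sq, show 2 * -(7 / 16 : ℝ) = -(7 / 8) by norm_num,
      ← bracketPow_neg_left (σ - (τ - _)), Prod.mk_sub_mk]
    ring_nf
  · rw [← bracketPow_neg_left]
    congr 2
    simp only [schrodingerPhase, airyPhase]
    push_cast
    ring

/-- With the frequency of the first factor fixed, the resonance function is a monic cubic in the
output frequency. -/
theorem exists_lintegral_kernel_left_le : ∃ C : ℝ≥0∞, C < ∞ ∧ ∀ w : ℤ × ℝ,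
    ∫⁻ z, kernelLeft z w ^ 2 ∂freqMeasure ≤ C := by
  unfold kernelLeft
  obtain ⟨C₁, hC₁, h₁⟩ := exists_lintegral_bracketPow_mul_le
  obtain ⟨C₂, hC₂, h₂⟩ := exists_tsum_bracketPow_cubic_le
  refine ⟨C₁ * C₂, ENNReal.mul_lt_top hC₁ hC₂, fun w => ?_⟩
  obtain ⟨m, σ⟩ := w
  rw [lintegral_freqMeasure (by fun_prop)]
  refine le_trans ?_ (mul_le_mul_right (h₂ (1 - 3 * m) (3 * m ^ 2) (σ - m ^ 3)) C₁)
  rw [← ENNReal.tsum_mul_left]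
  refine ENNReal.tsum_le_tsum fun n => ?_
  refine le_trans (le_of_eq ?_) ((h₁ (schrodingerPhase n) (σ + airyPhase (n - m))).trans
    (le_of_eq ?_))
  · refine lintegral_congr fun τ => ?_
    rw [mul_pow, bracketPow_sq, bracketPow_sq, show 2 * -(7 / 16 : ℝ) = -(7 / 8) by norm_num,
      Prod.mk_sub_mk]
    ring_nf
  · rw [← bracketPow_neg_left]
    congr 2
    simp only [schrodingerPhase, airyPhase]
    push_cast
    ring

/-- With the frequency of the second factor fixed, the resonance function is only affine in `w.1`;
the sum converges because of the factor `⟨w.1⟩⁻¹` of the kernel. -/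
theorem exists_lintegral_kernel_right_le : ∃ C : ℝ≥0∞, C < ∞ ∧ ∀ y : ℤ × ℝ,
    ∫⁻ w, kernelRight (w + y) w ^ 2 ∂freqMeasure ≤ C := by
  unfold kernelRight
  obtain ⟨C₁, hC₁, h₁⟩ := exists_lintegral_bracketPow_mul_le
  refine ⟨(∑' m : ℤ, bracketPow m (-2)) * C₁,
    ENNReal.mul_lt_top (tsum_int_bracketPow_lt_top (by norm_num)) hC₁, fun y => ?_⟩
  rw [lintegral_freqMeasure (by fun_prop), ← ENNReal.tsum_mul_right]
  refine ENNReal.tsum_le_tsum fun m => ?_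
  have h := h₁ (schrodingerPhase (m + y.1) - y.2) (schrodingerPhase m)
  have h2 : ∀ σ : ℝ, (bracketPow m (-1) *
      (bracketPow (((m, σ) + y).2 - schrodingerPhase ((m, σ) + y).1) (-(7 / 16)) *
      bracketPow (σ - schrodingerPhase m) (-(7 / 16)))) ^ 2 = bracketPow m (-2) *
      (bracketPow (σ - (schrodingerPhase (m + y.1) - y.2)) (-(7 / 8)) *
        bracketPow (σ - schrodingerPhase m) (-(7 / 8))) := by
    intro σ
    rw [mul_pow, mul_pow, bracketPow_sq, bracketPow_sq, bracketPow_sq, Prod.fst_add, Prod.snd_add,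
      show σ - (schrodingerPhase (m + y.1) - y.2) = σ + y.2 - schrodingerPhase (m + y.1) by ring]
    norm_num
  simp only [h2]
  rw [lintegral_const_mul _ (by fun_prop)]
  refine mul_le_mul_right (h.trans ?_) _
  exact mul_le_of_le_one_right' (bracketPow_le_one _ (by norm_num))

/-- The weight `⟨n⟩^{3/2}`, restricted to modulations `x` at least comparable to `n³`. -/
noncomputable def resonantWeight (n : ℤ) (x : ℝ) : ℝ≥0∞ :=
  if bracket n ^ 3 ≤ 15000 * bracket x then bracketPow n (3 / 2) else 0

theorem measurable_resonantWeight :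
    Measurable fun p : ℤ × ℝ => resonantWeight p.1 p.2 := by
  unfold resonantWeight
  refine Measurable.ite (measurableSet_le ?_ ?_) (by fun_prop) measurable_const
  · exact (measurable_bracket.comp (measurable_intCast_real.comp measurable_fst)).pow_const 3
  · exact (measurable_bracket.comp measurable_snd).const_mul _

theorem bracketPow_three_half_le {n : ℤ} {x : ℝ} (h : bracket n ^ 3 ≤ 15000 * bracket x) :
    bracketPow n (3 / 2) ≤ 123 * bracketPow x (1 / 2) := by
  unfold bracketPow
  rw [show (123 : ℝ≥0∞) = ENNReal.ofReal 123 by simp, ← ENNReal.ofReal_mul (by norm_num)]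
  refine ENNReal.ofReal_le_ofReal ?_
  have hn := bracket_pos n
  have hx := bracket_pos x
  calc bracket n ^ (3 / 2 : ℝ) = (bracket n ^ 3) ^ (1 / 2 : ℝ) := by
        rw [← Real.rpow_natCast, ← Real.rpow_mul hn.le]
        norm_num
    _ ≤ (123 ^ (2 : ℝ) * bracket x) ^ (1 / 2 : ℝ) := by
        refine Real.rpow_le_rpow (by positivity) (h.trans ?_) (by norm_num)
        norm_num
        linarith
    _ = 123 * bracket x ^ (1 / 2 : ℝ) := by
        rw [Real.mul_rpow (by positivity) hx.le, ← Real.rpow_mul (by norm_num)]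
        norm_num

theorem resonantWeight_le (n : ℤ) (x : ℝ) :
    resonantWeight n x ≤ 123 * bracketPow x (1 / 2) := by
  unfold resonantWeight
  split_ifs with h
  · exact bracketPow_three_half_le h
  · exact zero_le

/-- The resonance identity: if the output frequency `n` dominates the frequency `m` of the first
factor, then one of the three modulations is at least comparable to `n³`. -/
theorem bracket_cube_le_modulation {n m : ℤ} (h : 2 * |(m : ℝ)| < |(n : ℝ)|) (τ σ : ℝ) :
    bracket n ^ 3 ≤ 15000 * bracket (τ - schrodingerPhase n) ∨
    bracket n ^ 3 ≤ 15000 * bracket (σ - schrodingerPhase m) ∨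
    bracket n ^ 3 ≤ 15000 * bracket (τ - σ - airyPhase (n - m)) := by
  have hsum : |(n - m : ℝ) ^ 3 + n ^ 2 - m ^ 2| ≤ |τ - schrodingerPhase n| +
      |σ - schrodingerPhase m| + |τ - σ - airyPhase (n - m)| := by
    have e : (n - m : ℝ) ^ 3 + n ^ 2 - m ^ 2 = (τ - schrodingerPhase n) -
        (σ - schrodingerPhase m) - (τ - σ - airyPhase (n - m)) := by
      simp only [schrodingerPhase, airyPhase]
      push_cast
      ring
    rw [e]
    refine (abs_sub _ _).trans (add_le_add_left (abs_sub _ _) _)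
  have hH : bracket n ^ 3 ≤ 5000 * (1 + |(n - m : ℝ) ^ 3 + n ^ 2 - m ^ 2|) := by
    have h1 : |(n - m : ℝ)| ^ 3 - |(n : ℝ)| ^ 2 ≤ |(n - m : ℝ) ^ 3 + n ^ 2 - m ^ 2| := by
      have h2 : |(n - m : ℝ) ^ 3| ≤ |(n - m : ℝ) ^ 3 + n ^ 2 - m ^ 2| + |(n : ℝ) ^ 2 - m ^ 2| := by
        have := abs_sub ((n - m : ℝ) ^ 3 + n ^ 2 - m ^ 2) ((n : ℝ) ^ 2 - m ^ 2)
        convert! this using 2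
        ring
      have h3 : |(n : ℝ) ^ 2 - m ^ 2| ≤ |(n : ℝ)| ^ 2 := by
        have h4 : |(m : ℝ)| ^ 2 ≤ |(n : ℝ)| ^ 2 :=
          pow_le_pow_left₀ (abs_nonneg _) (by linarith [abs_nonneg (m : ℝ)]) 2
        rw [sq_abs, sq_abs] at h4
        rw [sq_abs, abs_of_nonneg (by linarith)]
        linarith [sq_nonneg (m : ℝ)]
      rw [abs_pow] at h2
      linarith
    have ht : |(n : ℝ)| ≤ 2 * |(n - m : ℝ)| := by
      have := abs_add_le (n - m : ℝ) m
      rw [sub_add_cancel] at this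
      linarith
    set t := |(n - m : ℝ)|
    have ht0 : 0 ≤ t := abs_nonneg _
    set H := |(n - m : ℝ) ^ 3 + n ^ 2 - m ^ 2|
    have hH0 : 0 ≤ H := abs_nonneg _
    set x := |(n : ℝ)| with hx
    have hx0 : 0 ≤ x := abs_nonneg _
    have hb : bracket n = 1 + x := rfl
    rw [hb]
    have hx2 : x ^ 2 ≤ (2 * t) ^ 2 := pow_le_pow_left₀ hx0 ht 2
    have hx3 : (1 + x) ^ 3 ≤ (1 + 2 * t) ^ 3 := pow_le_pow_left₀ (by linarith) (by linarith) 3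
    -- For `t ≥ 8` the cube dominates the quadratic terms; for `t ≤ 8` use `17³ < 5000`.
    rcases le_total t 8 with h8 | h8
    · have : (1 + 2 * t) ^ 3 ≤ 17 ^ 3 := pow_le_pow_left₀ (by linarith) (by linarith) 3
      linarith
    · have h5 : (1 + 2 * t) ^ 3 ≤ (3 * t) ^ 3 := pow_le_pow_left₀ (by linarith) (by linarith) 3
      have h6 : 8 * t ^ 2 ≤ t ^ 3 := by nlinarith [sq_nonneg t]
      nlinarith [sq_nonneg t]
  -- Otherwise all three modulations are below `⟨n⟩³ / 15000`, contradicting `hH`.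
  unfold bracket at hH ⊢
  by_contra! hcon
  linarith [hcon.1, hcon.2.1, hcon.2.2]

theorem bracketPow_le_of_le {n m : ℤ} (h : |(n : ℝ)| ≤ 2 * |(m : ℝ)|) {k : ℝ} (hk : 0 ≤ k) :
    bracketPow n k ≤ ENNReal.ofReal (2 ^ k) * bracketPow m k := by
  unfold bracketPow
  rw [← ENNReal.ofReal_mul (by positivity)]
  refine ENNReal.ofReal_le_ofReal ?_
  rw [← Real.mul_rpow (by norm_num) (bracket_pos _).le]
  refine Real.rpow_le_rpow (bracket_pos _).le ?_ hk
  unfold bracket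
  linarith

/-- If the output frequency `n` dominates `m`, the derivative weights cost at most
`⟨n⟩^{3/2} ⟨m⟩⁻¹`. -/
theorem bracketPow_le_of_lt {n m : ℤ} (h : 2 * |(m : ℝ)| < |(n : ℝ)|) {k s : ℝ}
    (hs : 0 ≤ s) (hks : k - s ≤ 3 / 2) :
    bracketPow n k ≤ ENNReal.ofReal (2 ^ s) * (bracketPow m k * bracketPow (n - m : ℤ) s) *
      (bracketPow m (-1) * bracketPow n (3 / 2)) := by
  have hn := bracket_pos n
  have hm := bracket_pos m
  have hl := bracket_pos (n - m : ℤ)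
  unfold bracketPow
  rw [← ENNReal.ofReal_mul (by positivity), ← ENNReal.ofReal_mul (by positivity),
    ← ENNReal.ofReal_mul (by positivity), ← ENNReal.ofReal_mul (by positivity)]
  refine ENNReal.ofReal_le_ofReal ?_
  have h1 : bracket n ^ s ≤ 2 ^ s * bracket (n - m : ℤ) ^ s := by
    rw [← Real.mul_rpow (by norm_num) hl.le]
    refine Real.rpow_le_rpow hn.le ?_ hs
    unfold bracket
    push_cast
    have := abs_add_le (n - m : ℝ) m
    rw [sub_add_cancel] at this
    linarith
  have h2 : bracket n ^ k ≤ bracket m ^ (k - 1) * bracket n ^ (s + 3 / 2) := by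
    rcases le_total 1 k with hk | hk
    · calc bracket n ^ k ≤ bracket n ^ (s + 3 / 2) :=
            Real.rpow_le_rpow_of_exponent_le (one_le_bracket _) (by linarith)
        _ ≤ bracket m ^ (k - 1) * bracket n ^ (s + 3 / 2) :=
            le_mul_of_one_le_left (by positivity)
              (Real.one_le_rpow (one_le_bracket _) (by linarith))
    · calc bracket n ^ k ≤ bracket n ^ (k - 1 + (s + 3 / 2)) :=
            Real.rpow_le_rpow_of_exponent_le (one_le_bracket _) (by linarith)
        _ = bracket n ^ (k - 1) * bracket n ^ (s + 3 / 2) := Real.rpow_add hn _ _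
        _ ≤ bracket m ^ (k - 1) * bracket n ^ (s + 3 / 2) := by
            refine mul_le_mul_of_nonneg_right ?_ (by positivity)
            refine Real.rpow_le_rpow_of_nonpos hm ?_ (by linarith)
            unfold bracket
            linarith [abs_nonneg (m : ℝ)]
  calc bracket n ^ k ≤ bracket m ^ (k - 1) * bracket n ^ (s + 3 / 2) := h2
    _ = bracket m ^ k * bracket m ^ (-1 : ℝ) * (bracket n ^ s * bracket n ^ (3 / 2 : ℝ)) := by
        rw [Real.rpow_add hn, ← Real.rpow_add hm, ← sub_eq_add_neg]
    _ ≤ bracket m ^ k * bracket m ^ (-1 : ℝ) *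
          ((2 ^ s * bracket (n - m : ℤ) ^ s) * bracket n ^ (3 / 2 : ℝ)) := by gcongr
    _ = _ := by ring

/-- The derivative weight of the output is controlled by the weights of the factors together with
half a power of the largest modulation. -/
theorem exists_bracketPow_le {k s : ℝ} (hk : 0 ≤ k) (hs : 0 ≤ s) (hks : k - s ≤ 3 / 2) :
    ∃ C : ℝ≥0∞, C < ∞ ∧ ∀ (n m : ℤ) (τ σ : ℝ),
      bracketPow n k ≤ C * (bracketPow m k * bracketPow (n - m : ℤ) s) *
        (1 + resonantWeight n (τ - schrodingerPhase n) +
          bracketPow (σ - schrodingerPhase m) (1 / 2) +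
          bracketPow m (-1) * bracketPow (τ - σ - airyPhase (n - m)) (1 / 2)) := by
  -- The two summands come from the cases `|n| ≤ 2|m|` and `2|m| < |n|`; `123² ≥ 15000`.
  refine ⟨ENNReal.ofReal (2 ^ k) + ENNReal.ofReal (2 ^ s) * 123, by finiteness,
    fun n m τ σ => ?_⟩
  set P := bracketPow m k * bracketPow (n - m : ℤ) s
  rcases le_or_gt |(n : ℝ)| (2 * |(m : ℝ)|) with h | h
  · have h1 : (1 : ℝ≥0∞) ≤ bracketPow (n - m : ℤ) s :=
      (bracketPow_zero _).symm.le.trans (bracketPow_mono _ hs)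
    calc bracketPow n k ≤ ENNReal.ofReal (2 ^ k) * bracketPow m k := bracketPow_le_of_le h hk
      _ ≤ ENNReal.ofReal (2 ^ k) * P := mul_le_mul_right (le_mul_of_one_le_right' h1) _
      _ = ENNReal.ofReal (2 ^ k) * P * 1 := (mul_one _).symm
      _ ≤ _ := by
        refine mul_le_mul' (mul_le_mul_left le_self_add _) ?_
        rw [add_assoc, add_assoc]
        exact le_self_add
  · have hb := bracketPow_le_of_lt h hs hks
    have h0 : (1 : ℝ≥0∞) ≤ 123 := by norm_num
    have hm1 : bracketPow m (-1) ≤ 1 := bracketPow_le_one _ (by norm_num)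
    have key : ∀ X : ℝ≥0∞, bracketPow m (-1) * bracketPow n (3 / 2) ≤ 123 * X →
        X ≤ 1 + resonantWeight n (τ - schrodingerPhase n) +
          bracketPow (σ - schrodingerPhase m) (1 / 2) +
          bracketPow m (-1) * bracketPow (τ - σ - airyPhase (n - m)) (1 / 2) →
        bracketPow n k ≤ (ENNReal.ofReal (2 ^ k) + ENNReal.ofReal (2 ^ s) * 123) * P *
          (1 + resonantWeight n (τ - schrodingerPhase n) +
          bracketPow (σ - schrodingerPhase m) (1 / 2) +
          bracketPow m (-1) * bracketPow (τ - σ - airyPhase (n - m)) (1 / 2)) := by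
      intro X hX hX2
      calc bracketPow n k ≤ ENNReal.ofReal (2 ^ s) * P *
            (bracketPow m (-1) * bracketPow n (3 / 2)) := hb
        _ ≤ ENNReal.ofReal (2 ^ s) * P * (123 * X) := mul_le_mul_right hX _
        _ = ENNReal.ofReal (2 ^ s) * 123 * P * X := by ring
        _ ≤ _ := mul_le_mul' (mul_le_mul_left le_add_self _) hX2
    rcases bracket_cube_le_modulation h τ σ with hc | hc | hc
    · refine key (resonantWeight n (τ - schrodingerPhase n)) ?_ ?_
      · rw [resonantWeight, if_pos hc]
        exact mul_le_mul' (hm1.trans h0) le_rfl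
      · exact le_add_right (le_add_right le_add_self)
    · refine key (bracketPow (σ - schrodingerPhase m) (1 / 2)) ?_ ?_
      · exact (mul_le_of_le_one_left' hm1).trans (bracketPow_three_half_le hc)
      · exact le_add_right le_add_self
    · refine key (bracketPow m (-1) * bracketPow (τ - σ - airyPhase (n - m)) (1 / 2)) ?_ ?_
      · rw [mul_left_comm]
        exact mul_le_mul_right (bracketPow_three_half_le hc) _
      · exact le_add_self

/-! ### The bilinear estimate -/

theorem bracketPow_neg_mul_self (x a : ℝ) : bracketPow x (-a) * bracketPow x a = 1 := by
  rw [← bracketPow_add, neg_add_cancel, bracketPow_zero]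

theorem sq_add_add_le (x y z : ℝ≥0∞) : (x + y + z) ^ 2 ≤ 9 * (x ^ 2 + y ^ 2 + z ^ 2) := by
  have key : ∀ t : ℝ≥0∞, x ≤ t → y ≤ t → z ≤ t → t ^ 2 ≤ x ^ 2 + y ^ 2 + z ^ 2 →
      (x + y + z) ^ 2 ≤ 9 * (x ^ 2 + y ^ 2 + z ^ 2) := by
    intro t hx hy hz h
    calc (x + y + z) ^ 2 ≤ (t + t + t) ^ 2 := by gcongr
      _ = 9 * t ^ 2 := by ring
      _ ≤ _ := by gcongr
  rcases le_total x y with h1 | h1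
  · rcases le_total y z with h2 | h2
    · exact key z (h1.trans h2) h2 le_rfl le_add_self
    · exact key y h1 le_rfl h2 (le_add_right le_add_self)
  · rcases le_total x z with h2 | h2
    · exact key z h2 (h1.trans h2) le_rfl le_add_self
    · exact key x le_rfl h1 h2 (le_add_right le_self_add)

/-- The amplitude by which the weighted product exceeds a square integrable function. -/
noncomputable def amplitude (n : ℤ) (x : ℝ) : ℝ≥0∞ :=
  1 + resonantWeight n x + bracketPow x (7 / 16)

theorem measurable_amplitude : Measurable fun p : ℤ × ℝ => amplitude p.1 p.2 := by
  unfold amplitude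
  have := measurable_resonantWeight
  fun_prop

theorem measurable_bracketPow_mul_amplitude (n : ℤ) (b : ℝ) :
    Measurable fun τ => bracketPow (τ - b) (-1) * amplitude n (τ - b) := by
  have h : Measurable fun τ : ℝ => amplitude n (τ - b) :=
    measurable_amplitude.comp (g := fun p : ℤ × ℝ => amplitude p.1 p.2)
      (f := fun τ : ℝ => (n, τ - b)) (by fun_prop)
  fun_prop

theorem bracketPow_mul_amplitude_le (n : ℤ) (x : ℝ) :
    bracketPow x (-(1 / 2)) * amplitude n x ≤ 125 := by
  unfold amplitude
  rw [mul_add, mul_add, mul_one]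
  calc _ ≤ (1 : ℝ≥0∞) + 123 + 1 := by
        refine add_le_add (add_le_add (bracketPow_le_one _ (by norm_num)) ?_) ?_
        · refine (mul_le_mul_right (resonantWeight_le n x) _).trans (le_of_eq ?_)
          rw [mul_left_comm, bracketPow_neg_mul_self, mul_one]
        · rw [← bracketPow_add]
          exact bracketPow_le_one _ (by norm_num)
    _ = 125 := by norm_num

/-- The scale invariant integral `∫ R (R + |x|)⁻² dx` does not depend on `R`. -/
theorem lintegral_scaled_bracket {R : ℝ} (hR : 0 < R) :
    ∫⁻ x : ℝ, ENNReal.ofReal (R * (R + |x|) ^ (-2 : ℝ)) = ∫⁻ x, bracketPow x (-2) := by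
  have hint : Integrable fun x : ℝ => bracket x ^ (-2 : ℝ) := by
    have := integrable_one_add_norm (E := ℝ) (μ := volume) (r := 2) (by simp)
    simpa [bracket] using this
  have hnn : ∀ x : ℝ, 0 ≤ bracket x ^ (-2 : ℝ) := fun x => by
    have := bracket_pos x
    positivity
  have hpt : ∀ x : ℝ, R * (R + |x|) ^ (-2 : ℝ) = R⁻¹ * bracket (x / R) ^ (-2 : ℝ) := by
    intro x
    have e : R + |x| = R * bracket (x / R) := by
      unfold bracket
      rw [abs_div, abs_of_pos hR]
      field_simp
    rw [e, Real.mul_rpow hR.le (bracket_pos _).le, ← mul_assoc]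
    congr 1
    rw [Real.rpow_neg hR.le]
    norm_num
    field_simp
  simp only [hpt]
  unfold bracketPow
  rw [← ofReal_integral_eq_lintegral_ofReal hint (Filter.Eventually.of_forall hnn),
    ← ofReal_integral_eq_lintegral_ofReal ((hint.comp_div hR.ne').const_mul _)
      (Filter.Eventually.of_forall fun x => mul_nonneg (inv_nonneg.2 hR.le) (hnn _)),
    integral_const_mul, Measure.integral_comp_div (fun x : ℝ => bracket x ^ (-2 : ℝ)),
    abs_of_pos hR,
    smul_eq_mul, inv_mul_cancel_left₀ hR.ne']

theorem sq_bracketPow_mul_resonantWeight_le (n : ℤ) (x : ℝ) :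
    (bracketPow x (-1) * resonantWeight n x) ^ 2 ≤
      ENNReal.ofReal (15001 ^ 2) *
        ENNReal.ofReal (bracket n ^ 3 * (bracket n ^ 3 + |x|) ^ (-2 : ℝ)) := by
  unfold resonantWeight
  split_ifs with h
  · have hn := bracket_pos n
    have hx := bracket_pos x
    rw [mul_pow, bracketPow_sq, bracketPow_sq]
    unfold bracketPow
    rw [← ENNReal.ofReal_mul (by positivity), ← ENNReal.ofReal_mul (by positivity)]
    refine ENNReal.ofReal_le_ofReal ?_
    have h1 : (bracket n ^ 3 + |x|) / 15001 ≤ bracket x := by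
      have : |x| ≤ bracket x := by unfold bracket; linarith
      linarith
    have h0 : 0 < bracket n ^ 3 + |x| := by positivity
    have h2 : bracket x ^ (-2 : ℝ) ≤ ((bracket n ^ 3 + |x|) / 15001) ^ (-2 : ℝ) :=
      Real.rpow_le_rpow_of_nonpos (by positivity) h1 (by norm_num)
    have h3 : ((bracket n ^ 3 + |x|) / 15001) ^ (-2 : ℝ) =
        15001 ^ 2 * (bracket n ^ 3 + |x|) ^ (-2 : ℝ) := by
      rw [Real.div_rpow h0.le (by norm_num), Real.rpow_neg (by norm_num : (0 : ℝ) ≤ 15001)]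
      norm_num
      ring
    have h4 : bracket n ^ (2 * (3 / 2) : ℝ) = bracket n ^ 3 := by
      rw [← Real.rpow_natCast]
      norm_num
    rw [h3] at h2
    rw [h4, show (2 * -1 : ℝ) = -2 by norm_num]
    calc _ ≤ 15001 ^ 2 * (bracket n ^ 3 + |x|) ^ (-2 : ℝ) * bracket n ^ 3 :=
          mul_le_mul_of_nonneg_right h2 (by positivity)
      _ = _ := by ring
  · simp

theorem exists_lintegral_amplitude_le : ∃ C : ℝ≥0∞, C < ∞ ∧ ∀ (n : ℤ) (b : ℝ),
    ∫⁻ τ, (bracketPow (τ - b) (-1) * amplitude n (τ - b)) ^ 2 ≤ C := by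
  have h1 := lintegral_bracketPow_lt_top (a := -2) (by norm_num)
  have h2 := lintegral_bracketPow_lt_top (a := -(9 / 8)) (by norm_num)
  refine ⟨9 * ((∫⁻ x, bracketPow x (-2)) + ENNReal.ofReal (15001 ^ 2) * (∫⁻ x, bracketPow x (-2)) +
    ∫⁻ x, bracketPow x (-(9 / 8))), by finiteness, fun n b => ?_⟩
  rw [lintegral_sub_right_eq_self (fun x => (bracketPow x (-1) * amplitude n x) ^ 2) b]
  have hn := bracket_pos n
  calc ∫⁻ x, (bracketPow x (-1) * amplitude n x) ^ 2
      ≤ ∫⁻ x, 9 * (bracketPow x (-2) + ENNReal.ofReal (15001 ^ 2) *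
          ENNReal.ofReal (bracket n ^ 3 * (bracket n ^ 3 + |x|) ^ (-2 : ℝ)) +
          bracketPow x (-(9 / 8))) := by
        refine lintegral_mono fun x => ?_
        unfold amplitude
        simp only [mul_add, mul_one]
        rw [← mul_add, ← mul_add]
        refine (sq_add_add_le _ _ _).trans (mul_le_mul_right (add_le_add (add_le_add ?_ ?_) ?_) _)
        · rw [bracketPow_sq]
          norm_num
        · exact sq_bracketPow_mul_resonantWeight_le n x
        · rw [← bracketPow_add, bracketPow_sq]
          norm_num
    _ = _ := by
        rw [lintegral_const_mul _ (by fun_prop), lintegral_add_left (by fun_prop),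
          lintegral_add_left (by fun_prop), lintegral_const_mul _ (by fun_prop),
          lintegral_scaled_bracket (by positivity)]

/-- The density of the weighted `L²` norms at the frequency `w`. -/
noncomputable def weighted (h : ℤ → ℝ) (r b : ℝ) (f : ℤ × ℝ → ℝ≥0∞) (w : ℤ × ℝ) : ℝ≥0∞ :=
  bracketPow w.1 r * bracketPow (w.2 - h w.1) b * f w

theorem measurable_weighted (h : ℤ → ℝ) (r b : ℝ) {f : ℤ × ℝ → ℝ≥0∞} (hf : Measurable f) :
    Measurable (weighted h r b f) := by
  unfold weighted
  have : Measurable h := measurable_of_countable h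
  fun_prop

theorem weighted_mono (h : ℤ → ℝ) (r : ℝ) {b b' : ℝ} (hb : b ≤ b') (f : ℤ × ℝ → ℝ≥0∞)
    (w : ℤ × ℝ) : weighted h r b f w ≤ weighted h r b' f w :=
  mul_le_mul_left (mul_le_mul_right (bracketPow_mono _ hb) _) _

/-- The squared weighted `L²` norm. -/
noncomputable def weightedSq (h : ℤ → ℝ) (r b : ℝ) (f : ℤ × ℝ → ℝ≥0∞) : ℝ≥0∞ :=
  ∫⁻ w, weighted h r b f w ^ 2 ∂freqMeasure

theorem weightedSq_mono (h : ℤ → ℝ) (r : ℝ) {b b' : ℝ} (hb : b ≤ b') (f : ℤ × ℝ → ℝ≥0∞) :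
    weightedSq h r b f ≤ weightedSq h r b' f :=
  lintegral_mono fun w => pow_le_pow_left' (weighted_mono h r hb f w) 2

theorem lintegral_sq_add_add_le {α : Type*} [MeasurableSpace α] {μ : Measure α}
    {f₀ f₁ f₂ : α → ℝ≥0∞} (h₀ : Measurable f₀) (h₁ : Measurable f₁) (h₂ : Measurable f₂) :
    ∫⁻ x, (f₀ x + f₁ x + f₂ x) ^ 2 ∂μ ≤
      9 * (∫⁻ x, f₀ x ^ 2 ∂μ + ∫⁻ x, f₁ x ^ 2 ∂μ + ∫⁻ x, f₂ x ^ 2 ∂μ) := by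
  refine (lintegral_mono fun x => sq_add_add_le _ _ _).trans (le_of_eq ?_)
  rw [lintegral_const_mul _ (by fun_prop), lintegral_add_left (by fun_prop),
    lintegral_add_left (by fun_prop)]

theorem mul_lintegral_le_of_pointwise {α : Type*} [MeasurableSpace α] {μ : Measure α}
    {f f₀ f₁ f₂ : α → ℝ≥0∞} (h : Measurable f) (h₀ : Measurable f₀) (h₁ : Measurable f₁)
    (h₂ : Measurable f₂) {p C a : ℝ≥0∞}
    (hle : ∀ x, p * f x ≤ C * (a * (f₀ x + f₁ x + f₂ x))) :
    p * ∫⁻ x, f x ∂μ ≤ C * (a * (∫⁻ x, f₀ x ∂μ + ∫⁻ x, f₁ x ∂μ + ∫⁻ x, f₂ x ∂μ)) := by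
  rw [← lintegral_const_mul _ h]
  refine (lintegral_mono hle).trans (le_of_eq ?_)
  rw [lintegral_const_mul _ (by fun_prop), lintegral_const_mul _ (by fun_prop),
    lintegral_add_left (by fun_prop), lintegral_add_left (by fun_prop)]

/-- The summand of the weighted convolution with kernel `K`, where `b` and `b'` are the powers of
the modulations attached to the factors. -/
noncomputable def convolutionTerm (K : ℤ × ℝ → ℤ × ℝ → ℝ≥0∞) (k s b b' : ℝ)
    (f g : ℤ × ℝ → ℝ≥0∞) (z w : ℤ × ℝ) : ℝ≥0∞ :=
  K z w * (weighted schrodingerPhase k b f w * weighted airyPhase s b' g (z - w))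

theorem measurable_convolutionTerm {K : ℤ × ℝ → ℤ × ℝ → ℝ≥0∞}
    (hK : Measurable (Function.uncurry K)) (k s b b' : ℝ) {f g : ℤ × ℝ → ℝ≥0∞}
    (hf : Measurable f) (hg : Measurable g) :
    Measurable (Function.uncurry (convolutionTerm K k s b b' f g)) :=
  hK.mul (((measurable_weighted _ _ _ hf).comp measurable_snd).mul
    ((measurable_weighted _ _ _ hg).comp (measurable_fst.sub measurable_snd)))

/-- The pointwise form of the bilinear estimate. -/
theorem bracketPow_mul_le_convolutionTerm {k s : ℝ} {C : ℝ≥0∞} {z w : ℤ × ℝ}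
    (h : bracketPow z.1 k ≤ C * (bracketPow w.1 k * bracketPow (z - w).1 s) *
      (1 + resonantWeight z.1 (z.2 - schrodingerPhase z.1) +
        bracketPow (w.2 - schrodingerPhase w.1) (1 / 2) +
        bracketPow w.1 (-1) * bracketPow ((z - w).2 - airyPhase (z - w).1) (1 / 2)))
    (f g : ℤ × ℝ → ℝ≥0∞) :
    bracketPow z.1 k * (f w * g (z - w)) ≤
      C * (amplitude z.1 (z.2 - schrodingerPhase z.1) *
        (convolutionTerm kernelOutput k s (7 / 16) (7 / 16) f g z w +
          convolutionTerm kernelLeft k s (1 / 2) (7 / 16) f g z w +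
          convolutionTerm kernelRight k s (7 / 16) (1 / 2) f g z w)) := by
  simp only [convolutionTerm, kernelOutput, kernelLeft, kernelRight, weighted, amplitude]
  have e0 := bracketPow_neg_mul_self (z.2 - schrodingerPhase z.1) (7 / 16)
  have e1 := bracketPow_neg_mul_self (w.2 - schrodingerPhase w.1) (7 / 16)
  have e2 := bracketPow_neg_mul_self ((z - w).2 - airyPhase (z - w).1) (7 / 16)
  generalize bracketPow (z.2 - schrodingerPhase z.1) (7 / 16) = x at *
  generalize bracketPow (z.2 - schrodingerPhase z.1) (-(7 / 16)) = x' at *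
  generalize bracketPow (w.2 - schrodingerPhase w.1) (7 / 16) = y at *
  generalize bracketPow (w.2 - schrodingerPhase w.1) (-(7 / 16)) = y' at *
  generalize bracketPow ((z - w).2 - airyPhase (z - w).1) (7 / 16) = t at *
  generalize bracketPow ((z - w).2 - airyPhase (z - w).1) (-(7 / 16)) = t' at *
  generalize bracketPow (w.2 - schrodingerPhase w.1) (1 / 2) = Y at *
  generalize bracketPow ((z - w).2 - airyPhase (z - w).1) (1 / 2) = T at *
  generalize resonantWeight z.1 (z.2 - schrodingerPhase z.1) = W at *
  generalize bracketPow w.1 k = p at *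
  generalize bracketPow (z - w).1 s = q at *
  generalize bracketPow w.1 (-1) = r at *
  generalize f w = F at *
  generalize g (z - w) = G at *
  calc bracketPow z.1 k * (F * G) ≤ C * (p * q) * (1 + W + Y + r * T) * (F * G) :=
        mul_le_mul_left h _
    _ = C * ((1 + W) * (1 * 1 * (p * q * F * G)) +
          1 * 1 * (p * q * F * G * Y) + 1 * 1 * (p * q * F * G * r * T)) := by ring
    _ = C * ((1 + W) * ((y' * y) * (t' * t) * (p * q * F * G)) +
          (x' * x) * (t' * t) * (p * q * F * G * Y) +
          (x' * x) * (y' * y) * (p * q * F * G * r * T)) := by rw [e0, e1, e2]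
    _ = C * ((1 + W) * (y' * t' * (p * y * F * (q * t * G))) +
          x * (x' * t' * (p * Y * F * (q * t * G))) +
          x * (r * (x' * y') * (p * y * F * (q * T * G)))) := by ring
    _ ≤ C * ((1 + W + x) * (y' * t' * (p * y * F * (q * t * G))) +
          (1 + W + x) * (x' * t' * (p * Y * F * (q * t * G))) +
          (1 + W + x) * (r * (x' * y') * (p * y * F * (q * T * G)))) := by
        refine mul_le_mul_right (add_le_add (add_le_add ?_ ?_) ?_) _
        · exact mul_le_mul_left le_self_add _
        · exact mul_le_mul_left le_add_self _
        · exact mul_le_mul_left le_add_self _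
    _ = _ := by ring

/-- The weighted convolution is the amplitude times a function whose `L²` norm is controlled.
The three summands of that function carry the kernels for which the derivative weight falls on the
output, on the first and on the second factor. -/
theorem exists_convolution_le {k s : ℝ} (hk : 0 ≤ k) (hs : 0 ≤ s) (hks : k - s ≤ 3 / 2) :
    ∃ C : ℝ≥0∞, C < ∞ ∧ ∀ f g : ℤ × ℝ → ℝ≥0∞, Measurable f → Measurable g →
      ∃ R : ℤ × ℝ → ℝ≥0∞, Measurable R ∧
        (∀ z : ℤ × ℝ, bracketPow z.1 k * ∫⁻ w, f w * g (z - w) ∂freqMeasure ≤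
          C * (amplitude z.1 (z.2 - schrodingerPhase z.1) * R z)) ∧
        ∫⁻ z, R z ^ 2 ∂freqMeasure ≤
          C * (weightedSq schrodingerPhase k (7 / 16) f * weightedSq airyPhase s (1 / 2) g +
            weightedSq schrodingerPhase k (1 / 2) f * weightedSq airyPhase s (7 / 16) g) := by
  obtain ⟨C, hC, hpt⟩ := exists_bracketPow_le hk hs hks
  obtain ⟨M₀, hM₀, hK₀⟩ := exists_lintegral_kernel_output_le
  obtain ⟨M₁, hM₁, hK₁⟩ := exists_lintegral_kernel_left_le
  obtain ⟨M₂, hM₂, hK₂⟩ := exists_lintegral_kernel_right_le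
  refine ⟨C + 9 * (M₀ + M₁ + M₂), by finiteness, fun f g hf hg => ?_⟩
  have mX : ∀ b, Measurable (weighted schrodingerPhase k b f) := fun b =>
    measurable_weighted _ _ _ hf
  have mY : ∀ b, Measurable (weighted airyPhase s b g) := fun b => measurable_weighted _ _ _ hg
  have mI₀ := measurable_convolutionTerm measurable_kernelOutput k s (7 / 16) (7 / 16) hf hg
  have mI₁ := measurable_convolutionTerm measurable_kernelLeft k s (1 / 2) (7 / 16) hf hg
  have mI₂ := measurable_convolutionTerm measurable_kernelRight k s (7 / 16) (1 / 2) hf hg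
  have b0 := lintegral_sq_convolution_le_of_output (μ := freqMeasure) measurable_kernelOutput
    (mX (7 / 16)) (mY (7 / 16)) hK₀
  have b1 := lintegral_sq_convolution_le_of_left (μ := freqMeasure) measurable_kernelLeft
    (mX (1 / 2)) (mY (7 / 16)) hK₁
  have b2 := lintegral_sq_convolution_le_of_right (μ := freqMeasure) measurable_kernelRight
    (mX (7 / 16)) (mY (1 / 2)) hK₂
  have mR₀ := mI₀.lintegral_prod_right (ν := freqMeasure)
  have mR₁ := mI₁.lintegral_prod_right (ν := freqMeasure)
  have mR₂ := mI₂.lintegral_prod_right (ν := freqMeasure)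
  refine ⟨_, (mR₀.add mR₁).add mR₂, fun z => ?_, ?_⟩
  · refine le_trans ?_ (mul_le_mul_left (show C ≤ C + 9 * (M₀ + M₁ + M₂) from le_self_add) _)
    refine mul_lintegral_le_of_pointwise (by fun_prop) (mI₀.comp measurable_prodMk_left)
      (mI₁.comp measurable_prodMk_left) (mI₂.comp measurable_prodMk_left) fun w => ?_
    exact bracketPow_mul_le_convolutionTerm (hpt z.1 w.1 z.2 w.2) f g
  · refine (lintegral_sq_add_add_le mR₀ mR₁ mR₂).trans ?_
    have c0 : weightedSq schrodingerPhase k (7 / 16) f * weightedSq airyPhase s (7 / 16) g ≤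
        weightedSq schrodingerPhase k (7 / 16) f * weightedSq airyPhase s (1 / 2) g :=
      mul_le_mul_right (weightedSq_mono _ _ (by norm_num) _) _
    set Q₁ := weightedSq schrodingerPhase k (7 / 16) f * weightedSq airyPhase s (1 / 2) g
    set Q₂ := weightedSq schrodingerPhase k (1 / 2) f * weightedSq airyPhase s (7 / 16) g
    calc _ ≤ 9 * (M₀ * (Q₁ + Q₂) + M₁ * (Q₁ + Q₂) + M₂ * (Q₁ + Q₂)) := by
          refine mul_le_mul_right (add_le_add (add_le_add ?_ ?_) ?_) _
          · exact b0.trans (mul_le_mul_right (c0.trans le_self_add) _)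
          · exact b1.trans (mul_le_mul_right le_add_self _)
          · exact b2.trans (mul_le_mul_right le_self_add _)
      _ = 9 * (M₀ + M₁ + M₂) * (Q₁ + Q₂) := by ring
      _ ≤ _ := mul_le_mul_left le_add_self _

theorem ofReal_bracket_mul (n x r b : ℝ) :
    ENNReal.ofReal (bracket n ^ (2 * r) * bracket x ^ (2 * b)) =
      (bracketPow n r * bracketPow x b) ^ 2 := by
  rw [mul_pow, bracketPow_sq, bracketPow_sq, bracketPow, bracketPow, ENNReal.ofReal_mul]
  have := bracket_pos n
  positivity

theorem measurable_enorm_uncurry {F : ℤ → ℝ → ℂ} (hF : ∀ n, Measurable (F n)) :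
    Measurable fun w : ℤ × ℝ => ‖F w.1 w.2‖ₑ :=
  (measurable_from_prod_countable_right (f := fun w : ℤ × ℝ => F w.1 w.2) hF).enorm

theorem weightedL2_eq_rpow (h : ℤ → ℝ) (r b : ℝ) {F : ℤ → ℝ → ℂ} (hF : ∀ n, Measurable (F n)) :
    weightedL2 h r b F = weightedSq h r b (fun w => ‖F w.1 w.2‖ₑ) ^ (1 / 2 : ℝ) := by
  have hm := measurable_weighted h r b (measurable_enorm_uncurry hF)
  rw [weightedL2, weightedSq, lintegral_freqMeasure (by fun_prop)]
  simp only [weighted, ofReal_bracket_mul, mul_pow]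

theorem weightedL2_mono (h : ℤ → ℝ) (r : ℝ) {b b' : ℝ} (hb : b ≤ b') (F : ℤ → ℝ → ℂ) :
    weightedL2 h r b F ≤ weightedL2 h r b' F := by
  unfold weightedL2
  simp only [ofReal_bracket_mul]
  gcongr
  exact bracketPow_mono _ hb

theorem xNorm_mono (k : ℝ) {b b' : ℝ} (hb : b ≤ b') (f : Torus × ℝ → ℂ) :
    XNorm k b f ≤ XNorm k b' f :=
  iInf₂_mono fun _ _ => weightedL2_mono _ _ hb _

theorem yNorm_mono (s : ℝ) {b b' : ℝ} (hb : b ≤ b') (f : Torus × ℝ → ℂ) :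
    YNorm s b f ≤ YNorm s b' f :=
  iInf₂_mono fun _ _ => weightedL2_mono _ _ hb _

theorem sq_rpow_half (x : ℝ≥0∞) : (x ^ 2) ^ (1 / 2 : ℝ) = x := by
  rw [← ENNReal.rpow_natCast, ← ENNReal.rpow_mul]
  norm_num

theorem weightedL2_le_of_amplitude {k : ℝ} {F : ℤ → ℝ → ℂ} {C : ℝ≥0∞} {R : ℤ × ℝ → ℝ≥0∞}
    (hR : Measurable R) (h : ∀ (n : ℤ) (τ : ℝ), bracketPow n k * ‖F n τ‖ₑ ≤
      C * (amplitude n (τ - schrodingerPhase n) * R (n, τ))) :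
    weightedL2 schrodingerPhase k (-(1 / 2)) F ≤
      125 * C * (∫⁻ z, R z ^ 2 ∂freqMeasure) ^ (1 / 2 : ℝ) := by
  have hR2 : Measurable fun z => R z ^ 2 := hR.pow_const 2
  have hpt : ∀ (n : ℤ) (τ : ℝ), bracketPow n k * bracketPow (τ - schrodingerPhase n) (-(1 / 2)) *
      ‖F n τ‖ₑ ≤ 125 * C * R (n, τ) := by
    intro n τ
    calc _ = bracketPow (τ - schrodingerPhase n) (-(1 / 2)) * (bracketPow n k * ‖F n τ‖ₑ) := by
          ring
      _ ≤ bracketPow (τ - schrodingerPhase n) (-(1 / 2)) *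
          (C * (amplitude n (τ - schrodingerPhase n) * R (n, τ))) := mul_le_mul_right (h n τ) _
      _ = (bracketPow (τ - schrodingerPhase n) (-(1 / 2)) *
          amplitude n (τ - schrodingerPhase n)) * (C * R (n, τ)) := by ring
      _ ≤ 125 * (C * R (n, τ)) := mul_le_mul_left (bracketPow_mul_amplitude_le n _) _
      _ = _ := (mul_assoc _ _ _).symm
  calc weightedL2 schrodingerPhase k (-(1 / 2)) F
      ≤ ((125 * C) ^ 2 * ∫⁻ z, R z ^ 2 ∂freqMeasure) ^ (1 / 2 : ℝ) := by
        unfold weightedL2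
        refine ENNReal.rpow_le_rpow ?_ (by norm_num)
        rw [lintegral_freqMeasure hR2, ← ENNReal.tsum_mul_left]
        refine ENNReal.tsum_le_tsum fun n => ?_
        have mR : Measurable fun τ => R (n, τ) ^ 2 := hR2.comp measurable_prodMk_left
        rw [← lintegral_const_mul _ mR]
        refine lintegral_mono fun τ => ?_
        rw [ofReal_bracket_mul, ← mul_pow, ← mul_pow]
        exact pow_le_pow_left' (hpt n τ) 2
    _ = _ := by rw [ENNReal.mul_rpow_of_nonneg _ _ (by norm_num), sq_rpow_half]

theorem weightedL2L1_le_of_amplitude {B : ℝ≥0∞}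
    (hB : ∀ (n : ℤ) (b : ℝ), ∫⁻ τ, (bracketPow (τ - b) (-1) * amplitude n (τ - b)) ^ 2 ≤ B)
    {k : ℝ} {F : ℤ → ℝ → ℂ} {C : ℝ≥0∞} {R : ℤ × ℝ → ℝ≥0∞}
    (hR : Measurable R) (h : ∀ (n : ℤ) (τ : ℝ), bracketPow n k * ‖F n τ‖ₑ ≤
      C * (amplitude n (τ - schrodingerPhase n) * R (n, τ))) :
    weightedL2L1 schrodingerPhase k F ≤
      B ^ (1 / 2 : ℝ) * C * (∫⁻ z, R z ^ 2 ∂freqMeasure) ^ (1 / 2 : ℝ) := by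
  have hR2 : Measurable fun z => R z ^ 2 := hR.pow_const 2
  have hpt : ∀ (n : ℤ) (τ : ℝ), ENNReal.ofReal (bracket n ^ k / bracket (τ - schrodingerPhase n)) *
      ‖F n τ‖ₑ ≤ (bracketPow (τ - schrodingerPhase n) (-1) *
        amplitude n (τ - schrodingerPhase n)) * (C * R (n, τ)) := by
    intro n τ
    have e : ENNReal.ofReal (bracket n ^ k / bracket (τ - schrodingerPhase n)) =
        bracketPow n k * bracketPow (τ - schrodingerPhase n) (-1) := by
      unfold bracketPow
      have := bracket_pos n
      rw [← ENNReal.ofReal_mul (by positivity), Real.rpow_neg_one, div_eq_mul_inv]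
    rw [e]
    calc _ = bracketPow (τ - schrodingerPhase n) (-1) * (bracketPow n k * ‖F n τ‖ₑ) := by ring
      _ ≤ bracketPow (τ - schrodingerPhase n) (-1) *
          (C * (amplitude n (τ - schrodingerPhase n) * R (n, τ))) := mul_le_mul_right (h n τ) _
      _ = _ := by ring
  have hcs : ∀ n : ℤ, (∫⁻ τ, ENNReal.ofReal (bracket n ^ k / bracket (τ - schrodingerPhase n)) *
      ‖F n τ‖ₑ) ^ 2 ≤ B * C ^ 2 * ∫⁻ τ, R (n, τ) ^ 2 := by
    intro n
    have mA := measurable_bracketPow_mul_amplitude n (schrodingerPhase n)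
    have mR : Measurable fun τ => R (n, τ) := hR.comp measurable_prodMk_left
    have h1 := pow_le_pow_left' (lintegral_mono (μ := volume) (hpt n)) 2
    have h2 := sq_lintegral_mul_le (μ := volume) mA (mR.const_mul C)
    have h3 : ∫⁻ τ, (C * R (n, τ)) ^ 2 = C ^ 2 * ∫⁻ τ, R (n, τ) ^ 2 := by
      simp only [mul_pow]
      exact lintegral_const_mul _ (mR.pow_const 2)
    rw [h3] at h2
    refine (h1.trans h2).trans ?_
    rw [mul_assoc]
    exact mul_le_mul_left (hB n (schrodingerPhase n)) _
  calc weightedL2L1 schrodingerPhase k F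
      ≤ (B * C ^ 2 * ∫⁻ z, R z ^ 2 ∂freqMeasure) ^ (1 / 2 : ℝ) := by
        unfold weightedL2L1
        refine ENNReal.rpow_le_rpow ?_ (by norm_num)
        rw [lintegral_freqMeasure hR2, ← ENNReal.tsum_mul_left]
        exact ENNReal.tsum_le_tsum hcs
    _ = _ := by
        rw [ENNReal.mul_rpow_of_nonneg _ _ (by norm_num),
          ENNReal.mul_rpow_of_nonneg _ _ (by norm_num), sq_rpow_half]

/-- A function dominated by the amplitude times an `L²` function has finite companion norm: the
amplitude is at most `⟨τ+n²⟩^{1/2}` up to a constant, and is square integrable in `τ` against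
`⟨τ+n²⟩⁻²`. -/
theorem exists_companion_norm_le : ∃ A : ℝ≥0∞, A < ∞ ∧ ∀ (k : ℝ) (F : ℤ → ℝ → ℂ)
    (C : ℝ≥0∞) (R : ℤ × ℝ → ℝ≥0∞), Measurable R →
    (∀ (n : ℤ) (τ : ℝ), bracketPow n k * ‖F n τ‖ₑ ≤
      C * (amplitude n (τ - schrodingerPhase n) * R (n, τ))) →
    weightedL2 schrodingerPhase k (-(1 / 2)) F + weightedL2L1 schrodingerPhase k F ≤
      A * C * (∫⁻ z, R z ^ 2 ∂freqMeasure) ^ (1 / 2 : ℝ) := by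
  obtain ⟨B, hB, hamp⟩ := exists_lintegral_amplitude_le
  refine ⟨125 + B ^ (1 / 2 : ℝ), by finiteness, fun k F C R hR h => ?_⟩
  rw [add_mul, add_mul]
  exact add_le_add (weightedL2_le_of_amplitude hR h) (weightedL2L1_le_of_amplitude hamp hR h)

theorem couplingEstimate_one_div_sixteen {k s : ℝ} (hk : 0 ≤ k) (hs : 0 ≤ s)
    (hks : k - s ≤ 3 / 2) : CouplingEstimate k s (1 / 16) := by
  obtain ⟨C, hC, hconv⟩ := exists_convolution_le hk hs hks
  obtain ⟨A, hA, hcomp⟩ := exists_companion_norm_le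
  refine ⟨(A * C * C ^ (1 / 2 : ℝ)).toNNReal, fun u v hu hv => ?_⟩
  rw [ENNReal.coe_toNNReal (by finiteness)]
  have hU := hasFourier_l2Fourier hu
  have hV := hasFourier_l2Fourier hv
  have hUV := hasFourier_intFourier (f := fun p => u p * v p) (MemLp.integrable_mul hu hv)
  rw [hU.xNorm_eq, hU.xNorm_eq, hV.yNorm_eq, hV.yNorm_eq,
    weightedL2_eq_rpow _ _ _ (measurable_l2Fourier hu),
    weightedL2_eq_rpow _ _ _ (measurable_l2Fourier hu),
    weightedL2_eq_rpow _ _ _ (measurable_l2Fourier hv),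
    weightedL2_eq_rpow _ _ _ (measurable_l2Fourier hv)]
  set f : ℤ × ℝ → ℝ≥0∞ := fun w => ‖l2Fourier hu w.1 w.2‖ₑ
  set g : ℤ × ℝ → ℝ≥0∞ := fun w => ‖l2Fourier hv w.1 w.2‖ₑ
  have mf : Measurable f := measurable_enorm_uncurry (measurable_l2Fourier hu)
  have mg : Measurable g := measurable_enorm_uncurry (measurable_l2Fourier hv)
  obtain ⟨R, hR, hpt, hint⟩ := hconv f g mf mg
  refine (hUV.zNorm_le k).trans ((hcomp k _ C R hR fun n τ => ?_).trans ?_)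
  · refine le_trans (mul_le_mul_right ?_ _) (hpt (n, τ))
    rw [lintegral_freqMeasure (by fun_prop)]
    exact enorm_intFourier_mul_le hu hv n τ
  · rw [mul_assoc (A * C)]
    refine mul_le_mul_right ?_ _
    rw [show (1 / 2 - 1 / 16 : ℝ) = 7 / 16 by norm_num,
      ← ENNReal.mul_rpow_of_nonneg _ _ (by norm_num : (0 : ℝ) ≤ 1 / 2),
      ← ENNReal.mul_rpow_of_nonneg _ _ (by norm_num : (0 : ℝ) ≤ 1 / 2)]
    refine (ENNReal.rpow_le_rpow hint (by norm_num)).trans ?_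
    rw [ENNReal.mul_rpow_of_nonneg _ _ (by norm_num)]
    exact mul_le_mul_right (ENNReal.rpow_add_le_add_rpow _ _ (by norm_num) (by norm_num)) _

theorem CouplingEstimate.mono {k s ε ε' : ℝ} (h : CouplingEstimate k s ε') (hε : ε ≤ ε') :
    CouplingEstimate k s ε := by
  obtain ⟨C, hC⟩ := h
  refine ⟨C, fun u v hu hv => (hC u v hu hv).trans (mul_le_mul_right (add_le_add ?_ ?_) _)⟩
  · exact mul_le_mul_left (xNorm_mono _ (by linarith) _) _
  · exact mul_le_mul_right (yNorm_mono _ (by linarith) _) _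

theorem CouplingEstimate.endpointEstimate {k s ε : ℝ} (hε : 0 < ε) (h : CouplingEstimate k s ε) :
    EndpointEstimate k s := by
  obtain ⟨C, hC⟩ := h.mono hε.le
  refine ⟨C * 2, fun u v hu hv => le_self_add.trans ((hC u v hu hv).trans (le_of_eq ?_))⟩
  rw [sub_zero]
  push_cast
  ring

/-! ### Gaussian wave packets and the necessity of the conditions -/

/-- The wave packet `e^{imx} e^{iλt} e^{-at²}`. -/
noncomputable def wave (m : ℤ) (lam a : ℝ) (p : Torus × ℝ) : ℂ :=
  fourier m p.1 * Complex.exp (Complex.I * lam * p.2 - a * p.2 ^ 2)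

theorem wave_mul_wave (m m' : ℤ) (lam lam' a a' : ℝ) (p : Torus × ℝ) :
    wave m lam a p * wave m' lam' a' p = wave (m + m') (lam + lam') (a + a') p := by
  unfold wave
  rw [fourier_add, mul_mul_mul_comm, ← Complex.exp_add]
  congr 2
  push_cast
  ring

theorem norm_wave (m : ℤ) (lam a : ℝ) (p : Torus × ℝ) :
    ‖wave m lam a p‖ = Real.exp (-a * p.2 ^ 2) := by
  rw [wave, norm_mul, norm_fourier_apply, one_mul, Complex.norm_exp]
  congr 1
  have : Complex.I * lam * p.2 - a * p.2 ^ 2 =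
      ((-a * p.2 ^ 2 : ℝ) : ℂ) + ((lam * p.2 : ℝ) : ℂ) * Complex.I := by
    push_cast
    ring
  rw [this, Complex.add_re, Complex.ofReal_re, Complex.re_ofReal_mul, Complex.I_re, mul_zero,
    add_zero]

theorem continuous_wave (m : ℤ) (lam a : ℝ) : Continuous (wave m lam a) := by
  unfold wave
  have := (fourier (T := 2 * Real.pi) m).continuous
  fun_prop

theorem integrable_exp_snd {a : ℝ} (ha : 0 < a) :
    Integrable (fun p : Torus × ℝ => Real.exp (-a * p.2 ^ 2)) := by
  have h : Integrable (fun p : Torus × ℝ => (1 : ℝ) * Real.exp (-a * p.2 ^ 2))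
      (volume.prod volume) :=
    (integrable_const (1 : ℝ)).mul_prod (integrable_exp_neg_mul_sq ha)
  simp only [one_mul] at h
  exact h

theorem integrable_wave (m : ℤ) (lam : ℝ) {a : ℝ} (ha : 0 < a) : Integrable (wave m lam a) :=
  (integrable_exp_snd ha).mono' (continuous_wave m lam a).aestronglyMeasurable
    (Filter.Eventually.of_forall fun p => (norm_wave m lam a p).le)

theorem memLp_wave (m : ℤ) (lam : ℝ) {a : ℝ} (ha : 0 < a) : MemLp (wave m lam a) 2 := by
  rw [memLp_two_iff_integrable_sq_norm (continuous_wave m lam a).aestronglyMeasurable]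
  refine (integrable_exp_snd (a := 2 * a) (by positivity)).congr
    (Filter.Eventually.of_forall fun p => ?_)
  simp only [norm_wave]
  rw [← Real.exp_nat_mul]
  congr 1
  push_cast
  ring

theorem intFourier_wave (m : ℤ) (lam : ℝ) {a : ℝ} (ha : 0 < a) (n : ℤ) (τ : ℝ) :
    intFourier (wave m lam a) n τ =
      if n = m then (Real.pi / a : ℂ) ^ (1 / 2 : ℂ) *
        Complex.exp (-((τ - lam : ℝ) : ℂ) ^ 2 / (4 * a)) else 0 := by
  have h1 : ∀ p : Torus × ℝ, fourier (-n) p.1 * wave m lam a p *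
      Complex.exp (-(Complex.I * p.2 * τ)) =
      (fourier (-n) p.1 * fourier m p.1) * (Complex.exp (Complex.I * ((lam - τ : ℝ) : ℂ) * p.2) *
        Complex.exp (-(a : ℂ) * p.2 ^ 2)) := by
    intro p
    rw [wave, ← Complex.exp_add, mul_assoc (fourier (-n) p.1), mul_assoc (fourier m p.1),
      ← Complex.exp_add, ← mul_assoc]
    congr 2
    push_cast
    ring
  have h2 : (2 * (Real.pi : ℂ))⁻¹ * ∫ x : Torus, fourier (-n) x * fourier m x =
      if n = m then 1 else 0 := by
    have h3 := congrFun (fourierCoeff_fourier (T := 2 * Real.pi) m) n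
    rw [fourierCoeff, AddCircle.integral_haarAddCircle, Complex.real_smul, Pi.single_apply] at h3
    simpa using h3
  have h4 : ∫ t : ℝ, Complex.exp (Complex.I * ((lam - τ : ℝ) : ℂ) * t) *
        Complex.exp (-(a : ℂ) * t ^ 2) = (Real.pi / a : ℂ) ^ (1 / 2 : ℂ) *
        Complex.exp (-((τ - lam : ℝ) : ℂ) ^ 2 / (4 * a)) := by
    rw [fourierIntegral_gaussian (by simpa using ha)]
    congr 3
    push_cast
    ring
  rw [intFourier]
  simp only [h1]
  rw [show (volume : Measure (Torus × ℝ)) = volume.prod volume from rfl,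
    integral_prod_mul (fun x : Torus => fourier (-n) x * fourier m x)
      (fun t : ℝ => Complex.exp (Complex.I * ((lam - τ : ℝ) : ℂ) * t) *
        Complex.exp (-(a : ℂ) * t ^ 2)), ← mul_assoc, h2, h4]
  split_ifs <;> simp

/-- The modulus of the Fourier transform of a wave packet, recentred. -/
noncomputable def waveProfile (a τ : ℝ) : ℝ≥0∞ :=
  ENNReal.ofReal (Real.sqrt (Real.pi / a) * Real.exp (-(τ ^ 2 / (4 * a))))

theorem enorm_intFourier_wave (m : ℤ) (lam : ℝ) {a : ℝ} (ha : 0 < a) (n : ℤ) (τ : ℝ) :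
    ‖intFourier (wave m lam a) n τ‖ₑ = if n = m then waveProfile a (τ - lam) else 0 := by
  rw [intFourier_wave m lam ha]
  split_ifs with h
  · rw [waveProfile, ← ofReal_norm, norm_mul]
    congr 2
    · rw [show (Real.pi / a : ℂ) = ((Real.pi / a : ℝ) : ℂ) by push_cast; rfl,
        show (1 / 2 : ℂ) = ((1 / 2 : ℝ) : ℂ) by push_cast; rfl,
        ← Complex.ofReal_cpow (by positivity), Complex.norm_real,
        Real.norm_of_nonneg (by positivity), Real.sqrt_eq_rpow]
    · rw [show -((τ - lam : ℝ) : ℂ) ^ 2 / (4 * a) = ((-((τ - lam) ^ 2 / (4 * a)) : ℝ) : ℂ) by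
        push_cast; ring, ← Complex.ofReal_exp, Complex.norm_real,
        Real.norm_of_nonneg (by positivity)]
  · simp

theorem measurable_waveProfile (a : ℝ) : Measurable (waveProfile a) := by
  unfold waveProfile
  fun_prop

theorem sq_weightedL2_wave (h : ℤ → ℝ) (r b : ℝ) (m : ℤ) (lam : ℝ) {a : ℝ} (ha : 0 < a) :
    weightedL2 h r b (intFourier (wave m lam a)) ^ 2 =
      bracketPow m (2 * r) * ∫⁻ τ, bracketPow (τ + (lam - h m)) (2 * b) * waveProfile a τ ^ 2 := by
  have hm := measurable_waveProfile a
  rw [weightedL2, ← ENNReal.rpow_natCast, ← ENNReal.rpow_mul]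
  norm_num
  rw [tsum_eq_single m]
  · simp only [enorm_intFourier_wave m lam ha, if_true]
    rw [← lintegral_const_mul _ (by fun_prop)]
    refine Eq.trans (lintegral_congr fun τ => ?_) (lintegral_sub_right_eq_self _ lam)
    rw [ofReal_bracket_mul, mul_pow, bracketPow_sq, bracketPow_sq, ← mul_assoc]
    congr 4
    ring
  · intro n hn
    simp [enorm_intFourier_wave m lam ha, hn]

theorem lintegral_bracketPow_mul_waveProfile_lt_top {a : ℝ} (ha : 0 < a) :
    ∫⁻ τ, bracketPow τ 1 * waveProfile a τ ^ 2 < ∞ := by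
  have ha' : 0 < 1 / (2 * a) := by positivity
  have h1 := integrable_exp_neg_mul_sq ha'
  have h2 := (integrable_mul_exp_neg_mul_sq ha').norm
  have h3 := ((h1.add h2).const_mul (Real.sqrt (Real.pi / a) ^ 2)).lintegral_lt_top
  refine lt_of_le_of_lt (lintegral_mono fun τ => le_of_eq ?_) h3
  rw [bracketPow, waveProfile, ← ENNReal.ofReal_pow (by positivity),
    ← ENNReal.ofReal_mul (by have := bracket_pos τ; positivity), Real.rpow_one]
  congr 1
  simp only [Pi.add_apply, norm_mul, Real.norm_eq_abs, abs_of_pos (Real.exp_pos _)]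
  rw [mul_pow, ← Real.exp_nat_mul, bracket]
  have : ((2 : ℕ) : ℝ) * -(τ ^ 2 / (4 * a)) = -(1 / (2 * a)) * τ ^ 2 := by
    push_cast
    field_simp
    norm_num
    ring
  rw [this]
  ring

theorem lintegral_bracketPow_mul_waveProfile_pos {a : ℝ} (ha : 0 < a) :
    ∫⁻ τ, bracketPow τ (-1) * waveProfile a τ ^ 2 ≠ 0 := by
  have hm := measurable_waveProfile a
  rw [← pos_iff_ne_zero, lintegral_pos_iff_support (by fun_prop)]
  have : Function.support (fun τ => bracketPow τ (-1) * waveProfile a τ ^ 2) = Set.univ := by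
    ext τ
    have hb := bracket_pos τ
    have h1 : bracketPow τ (-1) ≠ 0 := by
      rw [bracketPow, Ne, ENNReal.ofReal_eq_zero, not_le]
      positivity
    have h2 : waveProfile a τ ≠ 0 := by
      rw [waveProfile, Ne, ENNReal.ofReal_eq_zero, not_le]
      positivity
    simp [h1, h2]
  rw [this]
  simp

theorem bracketPow_mul_le_bracketPow_add (x y : ℝ) :
    bracketPow y (-1) * bracketPow x (-1) ≤ bracketPow (x + y) (-1) := by
  have hx := bracket_pos x
  have hy := bracket_pos y
  unfold bracketPow
  rw [← ENNReal.ofReal_mul (by positivity), ← Real.mul_rpow hy.le hx.le]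
  refine ENNReal.ofReal_le_ofReal
    (Real.rpow_le_rpow_of_nonpos (bracket_pos _) ?_ (by norm_num))
  rw [mul_comm]
  exact bracket_add_le_mul x y

/-- Testing the endpoint estimate on wave packets travelling with the two linear flows. -/
theorem EndpointEstimate.exists_bracket_le {k s : ℝ} (h : EndpointEstimate k s) :
    ∃ D : ℝ, 0 ≤ D ∧ ∀ m l : ℤ, bracket (m + l : ℤ) ^ (2 * k) *
      (bracket (schrodingerPhase m + airyPhase l - schrodingerPhase (m + l)))⁻¹ ≤
      D * (bracket m ^ (2 * k) * bracket l ^ (2 * s)) := by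
  obtain ⟨C, hC⟩ := h
  set c := ∫⁻ τ, bracketPow τ 1 * waveProfile 1 τ ^ 2 with hc
  set c' := ∫⁻ τ, bracketPow τ (-1) * waveProfile 2 τ ^ 2 with hc'
  have hcfin : c < ∞ := lintegral_bracketPow_mul_waveProfile_lt_top one_pos
  have hc0 : c' ≠ 0 := lintegral_bracketPow_mul_waveProfile_pos two_pos
  have hcfin' : c' ≠ ∞ := by
    refine ne_top_of_le_ne_top
      (lintegral_bracketPow_mul_waveProfile_lt_top two_pos).ne (lintegral_mono fun τ => ?_)
    exact mul_le_mul_left (bracketPow_mono _ (by norm_num)) _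
  have hD : (C : ℝ≥0∞) ^ 2 * (c * c) / c' ≠ ∞ := ENNReal.div_ne_top (by finiteness) hc0
  refine ⟨((C : ℝ≥0∞) ^ 2 * (c * c) / c').toReal, ENNReal.toReal_nonneg, fun m l => ?_⟩
  have hu := hasFourier_intFourier (integrable_wave m (schrodingerPhase m) one_pos)
  have hv := hasFourier_intFourier (integrable_wave l (airyPhase l) one_pos)
  have huv := hasFourier_intFourier
    (integrable_wave (m + l) (schrodingerPhase m + airyPhase l) (a := 1 + 1) (by norm_num))
  have h0 := hC _ _ (memLp_wave m (schrodingerPhase m) one_pos)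
    (memLp_wave l (airyPhase l) one_pos)
  simp only [wave_mul_wave] at h0
  rw [hu.xNorm_eq, hv.yNorm_eq] at h0
  have h1 := pow_le_pow_left' ((huv.xNorm_eq k (-(1 / 2))).symm.le.trans h0) 2
  rw [mul_pow, mul_pow, sq_weightedL2_wave _ _ _ _ _ one_pos, sq_weightedL2_wave _ _ _ _ _ one_pos,
    sq_weightedL2_wave _ _ _ _ _ (by norm_num)] at h1
  norm_num only [sub_self, add_zero] at h1
  rw [← hc] at h1
  set H := schrodingerPhase m + airyPhase l - schrodingerPhase (m + l) with hH
  have h2 : bracketPow H (-1) * c' ≤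
      ∫⁻ τ, bracketPow (τ + H) (-1) * waveProfile 2 τ ^ 2 := by
    have hm := measurable_waveProfile 2
    rw [hc', ← lintegral_const_mul _ (by fun_prop)]
    refine lintegral_mono fun τ => ?_
    rw [← mul_assoc]
    exact mul_le_mul_left (bracketPow_mul_le_bracketPow_add τ H) _
  have h3 : bracketPow (m + l : ℤ) (2 * k) * bracketPow H (-1) ≤
      ((C : ℝ≥0∞) ^ 2 * (c * c) / c') * (bracketPow m (2 * k) * bracketPow l (2 * s)) := by
    rw [← ENNReal.mul_le_mul_iff_left hc0 hcfin']
    calc bracketPow (m + l : ℤ) (2 * k) * bracketPow H (-1) * c'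
        ≤ bracketPow (m + l : ℤ) (2 * k) *
            ∫⁻ τ, bracketPow (τ + H) (-1) * waveProfile 2 τ ^ 2 := by
          rw [mul_assoc]
          exact mul_le_mul_right h2 _
      _ ≤ _ := h1
      _ = (C : ℝ≥0∞) ^ 2 * (c * c) * (bracketPow m (2 * k) * bracketPow l (2 * s)) := by ring
      _ = _ := by
          rw [mul_right_comm (_ / c'), ENNReal.div_mul_cancel hc0 hcfin']
  have p1 := bracket_pos (m + l : ℤ)
  have p2 := bracket_pos H
  have p3 := bracket_pos m
  have p4 := bracket_pos l
  rw [← ENNReal.ofReal_toReal hD] at h3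
  unfold bracketPow at h3
  rw [← ENNReal.ofReal_mul (by positivity), ← ENNReal.ofReal_mul (by positivity),
    ← ENNReal.ofReal_mul (by positivity), ENNReal.ofReal_le_ofReal_iff (by positivity),
    Real.rpow_neg_one] at h3
  exact h3

/-- Taking `l = 2j` and `m = -j(2j+1)` makes the interaction resonant, with `|m|` and `|m + l|`
comparable. -/
theorem EndpointEstimate.nonneg {k s : ℝ} (h : EndpointEstimate k s) : 0 ≤ s := by
  obtain ⟨D, hD, hb⟩ := h.exists_bracket_le
  by_contra! hs
  have hle : ∀ j : ℕ, 1 ≤ j → (3 : ℝ) ^ (-|2 * k|) ≤ D * (1 + 2 * (j : ℝ)) ^ (2 * s) := by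
    intro j hj
    have hj' : (1 : ℝ) ≤ j := by exact_mod_cast hj
    have h1 := hb (-(j * (2 * j + 1))) (2 * j)
    have e0 : schrodingerPhase (-(j * (2 * j + 1))) + airyPhase (2 * j) -
        schrodingerPhase (-(j * (2 * j + 1)) + 2 * j) = 0 := by
      simp only [schrodingerPhase, airyPhase]
      push_cast
      ring
    rw [e0] at h1
    have e1 : bracket ((-((j : ℤ) * (2 * j + 1)) + 2 * j : ℤ) : ℝ) = 1 + (2 * (j : ℝ) ^ 2 - j) := by
      rw [bracket, abs_of_nonpos]
      · push_cast
        ring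
      · push_cast
        nlinarith
    have e2 : bracket ((-((j : ℤ) * (2 * j + 1)) : ℤ) : ℝ) = 1 + (2 * (j : ℝ) ^ 2 + j) := by
      rw [bracket, abs_of_nonpos]
      · push_cast
        ring
      · push_cast
        nlinarith
    have e3 : bracket ((2 * (j : ℤ) : ℤ) : ℝ) = 1 + 2 * (j : ℝ) := by
      rw [bracket, abs_of_nonneg]
      · push_cast
        ring
      · push_cast
        linarith
    rw [e1, e2, e3, show bracket 0 = 1 by simp [bracket], inv_one, mul_one] at h1
    set p := 1 + (2 * (j : ℝ) ^ 2 - j)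
    set q := 1 + (2 * (j : ℝ) ^ 2 + j)
    have hp : 0 < p := by
      simp only [p]
      nlinarith
    have hq : 0 < q := by positivity
    have hpq : p ≤ q := by
      simp only [p, q]
      linarith
    have hqp : q ≤ 3 * p := by
      simp only [p, q]
      nlinarith
    have h3 : (3 : ℝ) ^ (-|2 * k|) ≤ (p / q) ^ (2 * k) := by
      have hr1 : p / q ≤ 1 := (div_le_one hq).2 hpq
      have hr0 : 0 < p / q := by positivity
      have hr3 : 1 / 3 ≤ p / q := by
        rw [div_le_div_iff₀ (by norm_num) hq]
        linarith
      calc (3 : ℝ) ^ (-|2 * k|) = (1 / 3 : ℝ) ^ |2 * k| := by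
            rw [Real.rpow_neg (by norm_num), one_div, Real.inv_rpow (by norm_num)]
        _ ≤ (p / q) ^ |2 * k| := Real.rpow_le_rpow (by norm_num) hr3 (abs_nonneg _)
        _ ≤ (p / q) ^ (2 * k) := Real.rpow_le_rpow_of_exponent_ge hr0 hr1 (le_abs_self _)
    refine h3.trans ?_
    rw [Real.div_rpow hp.le hq.le, div_le_iff₀ (by positivity)]
    linarith
  have hlim : Filter.Tendsto (fun j : ℕ => D * (1 + 2 * (j : ℝ)) ^ (2 * s)) Filter.atTop
      (nhds (D * 0)) := by
    refine Filter.Tendsto.const_mul D ?_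
    have h1 := tendsto_rpow_neg_atTop (y := -(2 * s)) (by linarith)
    rw [neg_neg] at h1
    refine h1.comp (Filter.tendsto_atTop_add_const_left _ _ ?_)
    exact tendsto_natCast_atTop_atTop.const_mul_atTop (by norm_num)
  have h0 := ge_of_tendsto hlim (Filter.eventually_atTop.2 ⟨1, hle⟩)
  rw [mul_zero] at h0
  have : (0 : ℝ) < (3 : ℝ) ^ (-|2 * k|) := by positivity
  linarith

/-- Taking `m = 0` makes all the derivatives fall on the second factor, while the output has
modulation of size `l³`. -/
theorem EndpointEstimate.sub_le {k s : ℝ} (h : EndpointEstimate k s) : k - s ≤ 3 / 2 := by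
  obtain ⟨D, hD, hb⟩ := h.exists_bracket_le
  by_contra! hks
  have hle : ∀ N : ℕ, (1 + (N : ℝ)) ^ (2 * k - 2 * s - 3) ≤ D := by
    intro N
    have h1 := hb 0 N
    have hN : 0 < 1 + (N : ℝ) := by positivity
    have e1 : bracket ((0 + (N : ℤ) : ℤ) : ℝ) = 1 + (N : ℝ) := by simp [bracket]
    have e2 : bracket ((N : ℤ) : ℝ) = 1 + (N : ℝ) := by simp [bracket]
    have e3 : bracket ((0 : ℤ) : ℝ) = 1 := by simp [bracket]
    have e4 : bracket (schrodingerPhase 0 + airyPhase N - schrodingerPhase (0 + N)) ≤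
        (1 + (N : ℝ)) ^ 3 := by
      have : schrodingerPhase 0 + airyPhase N - schrodingerPhase (0 + N) =
          (N : ℝ) ^ 3 + (N : ℝ) ^ 2 := by
        simp only [schrodingerPhase, airyPhase]
        push_cast
        ring
      rw [this, bracket, abs_of_nonneg (by positivity)]
      nlinarith [sq_nonneg (N : ℝ)]
    rw [e1, e2, e3, Real.one_rpow, one_mul] at h1
    have h2 : (1 + (N : ℝ)) ^ (2 * k) * ((1 + (N : ℝ)) ^ 3)⁻¹ ≤ D * (1 + (N : ℝ)) ^ (2 * s) := by
      refine le_trans (mul_le_mul_of_nonneg_left ?_ (by positivity)) h1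
      exact inv_anti₀ (bracket_pos _) e4
    rw [Real.rpow_sub hN, Real.rpow_sub hN, show (3 : ℝ) = ((3 : ℕ) : ℝ) by norm_num,
      Real.rpow_natCast, div_div, div_le_iff₀ (by positivity), ← mul_assoc]
    rw [← div_eq_mul_inv, div_le_iff₀ (by positivity)] at h2
    exact h2
  have hlim : Filter.Tendsto (fun N : ℕ => (1 + (N : ℝ)) ^ (2 * k - 2 * s - 3)) Filter.atTop
      Filter.atTop :=
    (tendsto_rpow_atTop (by linarith)).comp
      (Filter.tendsto_atTop_add_const_left _ _ tendsto_natCast_atTop_atTop)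
  obtain ⟨N, hN⟩ := (hlim.eventually (Filter.eventually_gt_atTop D)).exists
  exact absurd (hle N) (not_le.2 hN)

end NLSKdV

theorem proposition1 :
    (∃ ε₀ : ℝ, 0 < ε₀ ∧ ∀ ε : ℝ, 0 < ε → ε ≤ ε₀ → ∀ k s : ℝ,
      0 ≤ k → 0 ≤ s → k - s ≤ 3 / 2 → NLSKdV.CouplingEstimate k s ε) ∧
    (∀ k s ε : ℝ, 0 < ε → (s < 0 ∨ 3 / 2 < k - s) → ¬ NLSKdV.CouplingEstimate k s ε) ∧
    (∀ k s : ℝ, NLSKdV.EndpointEstimate k s → 0 ≤ s ∧ k - s ≤ 3 / 2) := by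
  refine ⟨⟨1 / 16, by norm_num, fun ε _ hε k s hk hs hks =>
    (NLSKdV.couplingEstimate_one_div_sixteen hk hs hks).mono hε⟩, fun k s ε hε hks hcoup => ?_,
    fun k s h => ⟨h.nonneg, h.sub_le⟩⟩
  have h := hcoup.endpointEstimate hε
  rcases hks with hs | hks
  · exact absurd h.nonneg (not_le.2 hs)
  · exact absurd h.sub_le (not_le.2 hks)
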